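/- Let $S$ be a string of $n\ge 2$ integers and let $\mathcal C$ be its Cartesian tree: the unlabelled ordered binary tree whose root corresponds to the leftmost occurrence of the minimum of $S$, and whose left and right subtrees are the Cartesian trees of the parts of $S$ before and after it; thus $S[i]$ corresponds to the $i$-th node of $\mathcal C$ in inorder. For a node $v$ of $\mathcal C$ let $\mathcal C(v)$ be the subtree rooted at $v$. A cluster with top boundary node $v$ is $\mathcal C(v)$ or $\{v\}\cup \mathcal C(v')$ for a child $v'$ of $v$, or is obtained from one of these by deleting all proper descendants of a node $u\ne v$ in it; in the last case $u$ is its bottom boundary node. A top-tree of $\mathcal C$ is an ordered binary tree, whose root is the cluster $\mathcal C$, whose leaves are the clusters formed by the single edges of $\mathcal C$ (labelled $e_\ell$ or $e_r$ according to whether the edge leads to a left or a right child; the lower endpoint is the bottom boundary node unless it is a leaf of $\mathcal C$), and in which each internal node is a cluster that is the union of its children $A$ and $B$, two clusters that have exactly one node in common: either the bottom boundary node of $A$, which is the top boundary node of $B$ (vertical merge), or the top boundary node of both (horizontal merge). Each internal node is labelled by its type of merge, where for horizontal merges it is also recorded whether the bottom boundary node of the union comes from $A$, comes from $B$, or does not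 exist. A top-tree compression $\mathcal T$ of $\mathcal C$ is the DAG obtained from a top-tree of $\mathcal C$ by representing all its nodes that have the same labelled rooted subtree by a single node. Let $|\mathcal T|$ be its number of nodes and $\mathrm{depth}(\mathcal T)$ the number of edges on a longest path from its source to a sink. For every $S$ and every top-tree compression $\mathcal T$ of the Cartesian tree of $S$ there is a data structure of $O(|\mathcal T|)$ words from which, on a word RAM (with unit-cost addition, subtraction, comparison and memory access, and words of $\log_2 n+O(1)$ bits), a fixed query program, using $O(|\mathcal T|)$ words of scratch space, computes for all $i\le j$ in $O(1+\mathrm{depth}(\mathcal T))$ time the answer $\mathrm{RMQ}(i,j)$, i.e. the position of the leftmost minimum of $S[i..j]$, which is also the inorder number of the lowest common ancestor in $\mathcal C$ of the nodes with inorder numbers $i$ and $j$. The implied constants are absolute. -/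

import Mathlib

namespace TopTreeRMQ

/-! ### Strings, range minima, Cartesian trees

Strings are lists of natural numbers; positions and inorder numbers are counted from `0`. -/

/-- `r` is the answer to the range minimum query `(i, j)` on `S`: the position of the smallest
entry of `S[i..j]`, the leftmost one in case of ties. -/
def IsRMQ (S : List ℕ) (i j r : ℕ) : Prop :=
  i ≤ r ∧ r ≤ j ∧ j < S.length ∧
    (∀ k, i ≤ k → k ≤ j → S.getD r 0 ≤ S.getD k 0) ∧
    (∀ k, i ≤ k → k < r → S.getD r 0 < S.getD k 0)

/-- The position of the first occurrence of the smallest entry of `S`. -/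
def minPos (S : List ℕ) : ℕ :=
  S.findIdx fun a => S.all fun b => decide (a ≤ b)

theorem minPos_lt {S : List ℕ} (h : S ≠ []) : minPos S < S.length := by
  unfold minPos
  rw [List.findIdx_lt_length]
  have hne : S.toFinset.Nonempty := by
    obtain ⟨a, ha⟩ := List.exists_mem_of_ne_nil S h
    exact ⟨a, by simpa using ha⟩
  obtain ⟨a, ha, hmin⟩ := S.toFinset.exists_min_image id hne
  exact ⟨a, by simpa using ha, by simpa using hmin⟩

/-- The Cartesian tree of a string, an ordered (unlabelled) binary tree: the root stands for the
first occurrence of the minimum, and the left and right subtrees are the Cartesian trees of the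
parts of the string before and after it. -/
def cartesianTree (S : List ℕ) : BinaryTree Unit :=
  if h : S = [] then .nil
  else
    have := minPos_lt h
    .node () (cartesianTree (S.take (minPos S))) (cartesianTree (S.drop (minPos S + 1)))
termination_by S.length
decreasing_by
  · simp only [List.length_take]; omega
  · simp only [List.length_drop]; omega

/-! ### Nodes of a binary tree, inorder numbers, lowest common ancestors -/

/-- A node of a binary tree, given by the path from the root to it
(`false` = go to the left child, `true` = go to the right child). -/
abbrev Node := List Bool

/-- The nodes of `T` in inorder; the entry at position `i` is the node with inorder number `i`. -/
def inorder : BinaryTree Unit → List Node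
  | .nil => []
  | .node _ l r => (inorder l).map (false :: ·) ++ [] :: (inorder r).map (true :: ·)

/-- The set of nodes of `T`. -/
def nodes (T : BinaryTree Unit) : Set Node := {u | u ∈ inorder T}

/-- `x` is the lowest common ancestor of the nodes `u` and `v`: a common ancestor of both (every
node being an ancestor of itself) that has every common ancestor among its ancestors. -/
def IsLCA (T : BinaryTree Unit) (u v x : Node) : Prop :=
  x ∈ nodes T ∧ x <+: u ∧ x <+: v ∧ ∀ y ∈ nodes T, y <+: u → y <+: v → y <+: x

/-- The lowest common ancestor of the nodes with inorder numbers `i` and `j` has inorder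
number `r`. -/
def IsInorderLCA (T : BinaryTree Unit) (i j r : ℕ) : Prop :=
  ∃ u v x : Node, (inorder T)[i]? = some u ∧ (inorder T)[j]? = some v ∧
    (inorder T)[r]? = some x ∧ IsLCA T u v x

/-! ### Clusters and top-trees -/

/-- The nodes of the subtree `T(v)` of `T` rooted at `v`. -/
def subtreeNodes (T : BinaryTree Unit) (v : Node) : Set Node := {w | w ∈ nodes T ∧ v <+: w}

/-- The data of a cluster: its nodes, its top boundary node and its bottom boundary node,
if there is one. -/
structure Cluster where
  carrier : Set Node
  top : Node
  bottom : Option Node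

/-- `C` is a cluster of `T`. A cluster with top boundary node `v` is `T(v)`, or `{v} ∪ T(v')` for a
child `v'` of `v`; for a node `u ≠ v` of such a cluster, deleting all proper descendants of `u`
gives a cluster with top boundary node `v` and bottom boundary node `u`. -/
def IsCluster (T : BinaryTree Unit) (C : Cluster) : Prop :=
  C.top ∈ nodes T ∧ ∃ base : Set Node,
    (base = subtreeNodes T C.top ∨
      ∃ b : Bool, C.top ++ [b] ∈ nodes T ∧
        base = insert C.top (subtreeNodes T (C.top ++ [b]))) ∧
    ((C.bottom = none ∧ C.carrier = base) ∨
      ∃ u, C.bottom = some u ∧ u ∈ base ∧ u ≠ C.top ∧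
        C.carrier = base \ {w | u <+: w ∧ w ≠ u})

/-- The types of merges of two clusters `A` and `B`: the vertical merge, and the horizontal merges
in which the bottom boundary node of the result is that of `A`, is that of `B`, or does not
exist. -/
inductive MergeType
  | vertical
  | horizontalLeft
  | horizontalRight
  | horizontalNone
  deriving DecidableEq

/-- The shape of a top-tree: an ordered binary tree, whose leaves are labelled by the two kinds of
single edges (`edge false` is an edge to a left child, `edge true` an edge to a right child) and
whose internal nodes are labelled by the type of merge. -/
inductive TopTree
  | edge (b : Bool)
  | merge (m : MergeType) (A B : TopTree)
  deriving DecidableEq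

/-- `Decomposes T τ C`: `τ` is a hierarchical decomposition of the cluster `C` of `T` into its
edges, by merges of clusters. -/
inductive Decomposes (T : BinaryTree Unit) : TopTree → Cluster → Prop
  /-- an edge to a leaf of `T`: no bottom boundary node -/
  | edgeLeaf (v : Node) (b : Bool) (hv : v ++ [b] ∈ nodes T)
      (hleaf : ∀ d : Bool, v ++ [b] ++ [d] ∉ nodes T) :
      Decomposes T (.edge b) ⟨{v, v ++ [b]}, v, none⟩
  /-- an edge to a node that has a child in `T` -/
  | edgeInner (v : Node) (b : Bool) (d : Bool) (hd : v ++ [b] ++ [d] ∈ nodes T) :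
      Decomposes T (.edge b) ⟨{v, v ++ [b]}, v, some (v ++ [b])⟩
  /-- the bottom boundary node of `A` is the top boundary node of `B` -/
  | vertical {a b : TopTree} {A B : Cluster} (hA : Decomposes T a A) (hB : Decomposes T b B)
      (hbd : A.bottom = some B.top) (hinter : A.carrier ∩ B.carrier = {B.top})
      (hC : IsCluster T ⟨A.carrier ∪ B.carrier, A.top, B.bottom⟩) :
      Decomposes T (.merge .vertical a b) ⟨A.carrier ∪ B.carrier, A.top, B.bottom⟩
  /-- `A` and `B` share their top boundary node, and only `A` has a bottom boundary node -/
  | horizontalLeft {a b : TopTree} {A B : Cluster} (hA : Decomposes T a A)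
      (hB : Decomposes T b B) (htop : A.top = B.top)
      (hinter : A.carrier ∩ B.carrier = {A.top}) (u : Node)
      (hbA : A.bottom = some u) (hbB : B.bottom = none)
      (hC : IsCluster T ⟨A.carrier ∪ B.carrier, A.top, some u⟩) :
      Decomposes T (.merge .horizontalLeft a b) ⟨A.carrier ∪ B.carrier, A.top, some u⟩
  /-- `A` and `B` share their top boundary node, and only `B` has a bottom boundary node -/
  | horizontalRight {a b : TopTree} {A B : Cluster} (hA : Decomposes T a A)
      (hB : Decomposes T b B) (htop : A.top = B.top)
      (hinter : A.carrier ∩ B.carrier = {A.top}) (u : Node)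
      (hbA : A.bottom = none) (hbB : B.bottom = some u)
      (hC : IsCluster T ⟨A.carrier ∪ B.carrier, A.top, some u⟩) :
      Decomposes T (.merge .horizontalRight a b) ⟨A.carrier ∪ B.carrier, A.top, some u⟩
  /-- `A` and `B` share their top boundary node, and none of them has a bottom boundary node -/
  | horizontalNone {a b : TopTree} {A B : Cluster} (hA : Decomposes T a A)
      (hB : Decomposes T b B) (htop : A.top = B.top)
      (hinter : A.carrier ∩ B.carrier = {A.top})
      (hbA : A.bottom = none) (hbB : B.bottom = none)
      (hC : IsCluster T ⟨A.carrier ∪ B.carrier, A.top, none⟩) :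
      Decomposes T (.merge .horizontalNone a b) ⟨A.carrier ∪ B.carrier, A.top, none⟩

/-- `τ` is a top-tree of `T`: a hierarchical decomposition whose root is the cluster `T` itself. -/
def IsTopTree (T : BinaryTree Unit) (τ : TopTree) : Prop :=
  Decomposes T τ ⟨nodes T, [], none⟩

/-! ### DAG compression -/

/-- The nodes of the DAG compression of `τ`: the distinct rooted subtrees of `τ`, each represented
once (the node of `merge m A B` has edges to the nodes of `A` and `B`; the source is `τ`). -/
def dagNodes : TopTree → Finset TopTree
  | .edge b => {.edge b}
  | .merge m A B => insert (.merge m A B) (dagNodes A ∪ dagNodes B)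

/-- The size of the DAG compression of `τ`. -/
def dagSize (τ : TopTree) : ℕ := (dagNodes τ).card

/-- The depth of the DAG compression of `τ`, i.e. the number of edges on a longest path from the
source to a sink; these paths are the root-to-leaf paths of `τ`. -/
def dagDepth : TopTree → ℕ
  | .edge _ => 0
  | .merge _ A B => max (dagDepth A) (dagDepth B) + 1

/-! ### Word RAM

A random access machine with words of `w` bits, that answers a query by accessing a read-only data
structure (an array of words) and a read-write scratch array. Every instruction takes unit time. -/

/-- Instructions; `r`, `s`, `t` are names of registers and `l` is a position in the program. -/
inductive Instr
  /-- `r := k` -/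
  | const (r k : ℕ)
  /-- `r := s` -/
  | move (r s : ℕ)
  /-- `r := s + t` -/
  | add (r s t : ℕ)
  /-- `r := s - t` -/
  | sub (r s t : ℕ)
  /-- `r :=` the word of the data structure at address `s` -/
  | read (r s : ℕ)
  /-- `r :=` the word of the scratch array at address `s` -/
  | load (r s : ℕ)
  /-- the word of the scratch array at address `r` `:= s` -/
  | store (r s : ℕ)
  /-- go to `l` -/
  | jump (l : ℕ)
  /-- go to `l` if `s = t` -/
  | jumpEq (s t l : ℕ)
  /-- go to `l` if `s < t` -/
  | jumpLt (s t l : ℕ)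
  /-- stop -/
  | halt

/-- A configuration: program counter, contents of the registers and of the scratch array. -/
structure Config where
  pc : ℕ
  reg : ℕ → ℕ
  mem : List ℕ

/-- Write `x` to register `r` and proceed to the next instruction. -/
def Config.put (s : Config) (r x : ℕ) : Config :=
  ⟨s.pc + 1, Function.update s.reg r x, s.mem⟩

/-- Execution of one instruction with words of `w` bits (arithmetic modulo `2 ^ w`) and data
structure `D`; `none` if the machine stops or uses an address outside of the arrays. -/
def exec (w : ℕ) (D : List ℕ) (s : Config) : Instr → Option Config
  | .const r k => some (s.put r (k % 2 ^ w))
  | .move r a => some (s.put r (s.reg a))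
  | .add r a b => some (s.put r ((s.reg a + s.reg b) % 2 ^ w))
  | .sub r a b => some (s.put r ((s.reg a + 2 ^ w - s.reg b) % 2 ^ w))
  | .read r a => D[s.reg a]?.map (s.put r)
  | .load r a => s.mem[s.reg a]?.map (s.put r)
  | .store r a =>
      if s.reg r < s.mem.length then
        some ⟨s.pc + 1, s.reg, s.mem.set (s.reg r) (s.reg a)⟩
      else none
  | .jump l => some ⟨l, s.reg, s.mem⟩
  | .jumpEq a b l => some ⟨if s.reg a = s.reg b then l else s.pc + 1, s.reg, s.mem⟩
  | .jumpLt a b l => some ⟨if s.reg a < s.reg b then l else s.pc + 1, s.reg, s.mem⟩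
  | .halt => none

/-- One step of the program `P`. -/
def step (w : ℕ) (P : List Instr) (D : List ℕ) (s : Config) : Option Config :=
  P[s.pc]?.bind (exec w D s)

/-- `t` steps of the program `P`. -/
def steps (w : ℕ) (P : List Instr) (D : List ℕ) : ℕ → Config → Option Config
  | 0, s => some s
  | t + 1, s => (step w P D s).bind (steps w P D t)

/-- The initial configuration for the query `(i, j)`: the two arguments are in the registers
`0` and `1`, the other registers are `0`. -/
def initConfig (i j : ℕ) (mem : List ℕ) : Config :=
  ⟨0, fun r => if r = 0 then i else if r = 1 then j else 0, mem⟩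

/-- With word size `w`, data structure `D` and initial contents `mem` of the scratch array, the
program `P` on the query `(i, j)` reaches a `halt` instruction after `t` steps, with `x` in
register `0`. -/
def Answers (w : ℕ) (P : List Instr) (D mem : List ℕ) (i j t x : ℕ) : Prop :=
  ∃ s : Config, steps w P D t (initConfig i j mem) = some s ∧
    P[s.pc]? = some .halt ∧ s.reg 0 = x

end TopTreeRMQ

open TopTreeRMQ

namespace TopTreeRMQ

/-! ### The inorder of paths -/

/-! Nodes are paths, so the lowest common ancestor of two nodes is their longest common prefix
`lcp`, and the inorder number of a node is the number of nodes preceding it, its rank `rk`. The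
Cartesian tree reduces the range minimum to this prefix (`exists_isRMQ_lcp`); it remains to find the
rank of `lcp x y` from the ranks of `x` and `y` by one descent through the DAG.

Sharing is harmless because the size of a cluster and the ranks inside it of its boundary nodes
depend only on the labelled shape of its subtree in the top-tree (`Shape.ranks`). A constant number
of such values is stored for each node of the DAG.

The descent keeps the invariant `QueryState`: the ranks, within the current cluster, of two nodes
whose `lcp` is the goal; two offsets that turn ranks in the cluster into global ranks, one for nodes
before the bottom boundary node and one for nodes after it; and the global rank of the top boundary
node. Two offsets suffice because the part of the tree cut off below the bottom boundary node is
inserted at a single place of the inorder of the cluster. The bottom boundary node itself gets no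
offset, since its left descendants are missing; without a bottom boundary node both offsets are
valid everywhere.

If the top boundary node lies weakly between the two query nodes, it is the goal (`lcp_between`).
Otherwise one child is entered. In a vertical merge of `A` with `B` hanging at `u`, the nodes of `B`
occupy an interval of ranks. If both query nodes lie in it, the descent goes to `B`; if not, a query
node in `B` is replaced by `u`, which changes neither its order nor its common prefix relative to
nodes not below `u`, and the descent goes to `A`. In a horizontal merge the common top separates the
parts, so both query nodes lie strictly on one side. At a single edge the top is always one of the
two query nodes, so the descent stops. Each level costs at most 38 instructions, and the bounds
`before_le` and `after_le` in the invariant exclude overflow. -/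

/-- `ilt u v`: the node `u` precedes the node `v` in inorder. -/
def ilt : Node → Node → Bool
  | [], [] => false
  | [], b :: _ => b
  | a :: _, [] => !a
  | a :: u, b :: v => if a = b then ilt u v else b

/-- The longest common prefix of two paths. -/
def lcp : Node → Node → Node
  | a :: u, b :: v => if a = b then a :: lcp u v else []
  | [], _ => []
  | _ :: _, [] => []

theorem ilt_irrefl (u : Node) : ilt u u = false := by
  induction u with
  | nil => rfl
  | cons a u ih => simp [ilt, ih]

theorem ilt_trichotomy (u v : Node) : u = v ∨ ilt u v = true ∨ ilt v u = true := by
  induction u generalizing v with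
  | nil => cases v with
    | nil => simp
    | cons b v => cases b <;> simp [ilt]
  | cons a u ih => cases v with
    | nil => cases a <;> simp [ilt]
    | cons b v =>
      have := ih v
      cases a <;> cases b <;> simp_all [ilt]

theorem ilt_trans {u v x : Node} (h : ilt u v = true) (h' : ilt v x = true) :
    ilt u x = true := by
  induction u generalizing v x with
  | nil =>
    rcases v with _ | ⟨b, v⟩
    · simp [ilt] at h
    · rcases x with _ | ⟨c, x⟩ <;> cases b <;> simp_all [ilt]
  | cons a u ih =>
    rcases v with _ | ⟨b, v⟩ <;> rcases x with _ | ⟨c, x⟩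
    · simp [ilt] at h'
    · cases a <;> cases c <;> simp_all [ilt]
    · cases a <;> cases b <;> simp_all [ilt]
    · have := @ih v x
      cases a <;> cases b <;> cases c <;> simp_all [ilt]

theorem ilt_asymm {u v : Node} (h : ilt u v = true) : ilt v u = false := by
  by_contra h'
  have := ilt_trans h (by simpa using h')
  simp [ilt_irrefl] at this

theorem ilt_ne {u v : Node} (h : ilt u v = true) : u ≠ v := by
  rintro rfl
  simp [ilt_irrefl] at h

/-- Since `z` is not below `u`, the comparison of `z` with `y` is already decided within the prefix
`u` of `y`. This is what allows a whole cluster hanging at `u` to be replaced by `u`. -/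
theorem ilt_right_of_prefix {u y z : Node} (hy : u <+: y) (hz : ¬ u <+: z) :
    ilt z y = ilt z u := by
  obtain ⟨w, rfl⟩ := hy
  induction u generalizing z with
  | nil => simp at hz
  | cons b u ih =>
    rcases z with _ | ⟨c, z⟩
    · simp [ilt]
    · by_cases h : c = b
      · subst h
        simpa [ilt] using ih (z := z) (by simpa using hz)
      · simp [ilt, h]

theorem ilt_left_of_prefix {u y z : Node} (hy : u <+: y) (hz : ¬ u <+: z) :
    ilt y z = ilt u z := by
  obtain ⟨w, rfl⟩ := hy
  induction u generalizing z with
  | nil => simp at hz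
  | cons b u ih =>
    rcases z with _ | ⟨c, z⟩
    · simp [ilt]
    · by_cases h : b = c
      · subst h
        simpa [ilt] using ih (z := z) (by simpa using hz)
      · simp [ilt, h]

theorem ilt_append (v x y : Node) : ilt (v ++ x) (v ++ y) = ilt x y := by
  induction v with
  | nil => rfl
  | cons a v ih => simpa [ilt] using ih

theorem ilt_self_iff {v x : Node} (h : v <+: x) : ilt v x = true ↔ v ++ [true] <+: x := by
  obtain ⟨w, rfl⟩ := h
  have := ilt_append v [] w
  rw [List.append_nil] at this
  rw [this, List.prefix_append_right_inj]
  rcases w with _ | ⟨b, w⟩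
  · simp [ilt]
  · cases b <;> simp [ilt]

theorem ilt_iff_self {v x : Node} (h : v <+: x) : ilt x v = true ↔ v ++ [false] <+: x := by
  obtain ⟨w, rfl⟩ := h
  have := ilt_append v w []
  rw [List.append_nil] at this
  rw [this, List.prefix_append_right_inj]
  rcases w with _ | ⟨b, w⟩
  · simp [ilt]
  · cases b <;> simp [ilt]

theorem lcp_comm (u v : Node) : lcp u v = lcp v u := by
  induction u generalizing v with
  | nil => cases v <;> rfl
  | cons a u ih =>
    rcases v with _ | ⟨b, v⟩
    · rfl
    · by_cases h : a = b
      · subst h; simp [lcp, ih v]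
      · simp [lcp, h, Ne.symm h]

/-- Same reason as for `ilt_right_of_prefix`: the paths part within `u`. Hence moving a query node
up to `u` preserves the goal. -/
theorem lcp_right_of_prefix {u y z : Node} (hy : u <+: y) (hz : ¬ u <+: z) :
    lcp z y = lcp z u := by
  obtain ⟨w, rfl⟩ := hy
  induction u generalizing z with
  | nil => simp at hz
  | cons b u ih =>
    rcases z with _ | ⟨c, z⟩
    · simp [lcp]
    · by_cases h : c = b
      · subst h
        simpa [lcp] using ih (z := z) (by simpa using hz)
      · simp [lcp, h]

theorem lcp_append (v x y : Node) : lcp (v ++ x) (v ++ y) = v ++ lcp x y := by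
  induction v with
  | nil => rfl
  | cons a v ih => simpa [lcp] using ih

/-- Either one of the two nodes is `v` itself, or `x` continues to the left of `v` and `y` to the
right; in both cases the paths part at `v`. -/
theorem lcp_between {v x y : Node} (hx : v <+: x) (hy : v <+: y)
    (hxv : ilt v x = false) (hvy : ilt y v = false) (hxy : ilt x y = true) : lcp x y = v := by
  obtain ⟨x, rfl⟩ := hx
  obtain ⟨y, rfl⟩ := hy
  have h1 := ilt_append v [] x
  have h2 := ilt_append v y []
  have h3 := ilt_append v x y
  rw [List.append_nil] at h1 h2
  rw [hxv] at h1
  rw [hvy] at h2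
  rw [hxy] at h3
  rw [lcp_append]
  rcases x with _ | ⟨b, x⟩ <;> rcases y with _ | ⟨c, y⟩
  · simp [lcp]
  · simp [lcp]
  · simp [lcp]
  · cases b <;> cases c <;> simp [ilt, lcp] at h1 h2 h3 ⊢

theorem lcp_prefix_left (u v : Node) : lcp u v <+: u := by
  induction u generalizing v with
  | nil => cases v <;> simp [lcp]
  | cons a u ih =>
    rcases v with _ | ⟨b, v⟩
    · simp [lcp]
    · by_cases h : a = b
      · subst h; simpa [lcp] using ih v
      · simp [lcp, h]

theorem prefix_lcp {u v y : Node} (hu : y <+: u) (hv : y <+: v) : y <+: lcp u v := by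
  obtain ⟨u, rfl⟩ := hu
  obtain ⟨v, rfl⟩ := hv
  rw [lcp_append]
  exact List.prefix_append _ _

/-! ### Inorder traversal of a tree -/

theorem inorder_pairwise (T : BinaryTree Unit) :
    (inorder T).Pairwise (fun u v => ilt u v = true) := by
  induction T with
  | nil => simp [inorder]
  | node _ l r ihl ihr =>
    simp only [inorder, List.pairwise_append, List.pairwise_map, List.pairwise_cons]
    refine ⟨by simpa [ilt] using ihl, ⟨by simp [ilt], by simpa [ilt] using ihr⟩, ?_⟩
    simp [ilt]

theorem inorder_nodup (T : BinaryTree Unit) : (inorder T).Nodup :=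
  (inorder_pairwise T).imp ilt_ne

/-- The number of elements of `F` that precede `x` in inorder. -/
def rk (F : Finset Node) (x : Node) : ℕ := (F.filter fun y => ilt y x = true).card

/-- The inorder list is strictly sorted by `ilt`, so the predecessors of its entry at position `k`
are exactly the first `k` entries. -/
theorem rk_inorder {T : BinaryTree Unit} {k : ℕ} {x : Node} (h : (inorder T)[k]? = some x) :
    rk (inorder T).toFinset x = k := by
  obtain ⟨hk, hx⟩ := List.getElem?_eq_some_iff.1 h
  have hp := List.pairwise_iff_getElem.1 (inorder_pairwise T)
  have hset : (inorder T).toFinset.filter (fun y => ilt y x = true)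
      = ((inorder T).take k).toFinset := by
    ext y
    simp only [Finset.mem_filter, List.mem_toFinset, List.mem_take_iff_getElem]
    constructor
    · rintro ⟨hy, hlt⟩
      obtain ⟨m, hm, rfl⟩ := List.getElem_of_mem hy
      refine ⟨m, ?_, rfl⟩
      by_contra hcon
      have hkm : k ≤ m := by omega
      rcases hkm.eq_or_lt with rfl | hkm
      · rw [hx, ilt_irrefl] at hlt; simp at hlt
      · have := hp k m hk hm hkm
        rw [hx] at this
        rw [ilt_asymm this] at hlt; simp at hlt
    · rintro ⟨m, hm, rfl⟩
      refine ⟨List.getElem_mem _, ?_⟩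
      have := hp m k (by omega) hk (by omega)
      rwa [hx] at this
  rw [rk, hset, List.toFinset_card_of_nodup ((inorder_nodup T).sublist (List.take_sublist _ _)),
    List.length_take]
  omega

/-! ### The Cartesian tree -/

theorem cartesianTree_cons {S : List ℕ} (h : S ≠ []) :
    cartesianTree S = .node () (cartesianTree (S.take (minPos S)))
      (cartesianTree (S.drop (minPos S + 1))) := by
  rw [cartesianTree, dif_neg h]

theorem minPos_spec {S : List ℕ} (h : S ≠ []) :
    (∀ k < S.length, S.getD (minPos S) 0 ≤ S.getD k 0) ∧
      ∀ k < minPos S, S.getD (minPos S) 0 < S.getD k 0 := by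
  have hlt := minPos_lt h
  have h1 : ∀ k < S.length, S.getD (minPos S) 0 ≤ S.getD k 0 := by
    intro k hk
    have := List.findIdx_getElem (xs := S) (p := fun a => S.all fun b => decide (a ≤ b))
      (w := hlt)
    simp only [List.all_eq_true, decide_eq_true_eq] at this
    rw [List.getD_eq_getElem _ _ hlt, List.getD_eq_getElem _ _ hk]
    exact this _ (List.getElem_mem _)
  refine ⟨h1, fun k hk => ?_⟩
  have hkS : k < S.length := hk.trans hlt
  have := List.not_of_lt_findIdx (xs := S) (p := fun a => S.all fun b => decide (a ≤ b)) hk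
  obtain ⟨b, hb, hlt'⟩ : ∃ b ∈ S, b < S[k] := by simpa using this
  obtain ⟨m, hm, rfl⟩ := List.getElem_of_mem hb
  have := h1 m hm
  rw [List.getD_eq_getElem _ _ hm] at this
  rw [List.getD_eq_getElem _ _ hkS]
  omega

theorem length_inorder_cartesianTree (S : List ℕ) :
    (inorder (cartesianTree S)).length = S.length := by
  induction hn : S.length using Nat.strong_induction_on generalizing S with
  | _ n ih =>
    by_cases h : S = []
    · subst h
      simp at hn
      subst hn
      rw [cartesianTree]
      simp [inorder]
    · have hlt := minPos_lt h
      rw [cartesianTree_cons h]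
      simp only [inorder, List.length_append, List.length_map, List.length_cons]
      rw [ih _ (by simp; omega) (S.take (minPos S)) rfl,
        ih _ (by simp; omega) (S.drop (minPos S + 1)) rfl]
      simp
      omega

/-- Induction along the construction of the tree. If the first minimum of `S` lies between `i` and
`j`, it is the answer and the two paths part at the root; otherwise both positions lie on the same
side, where the recursion applies and all paths gain the same first letter. One and the same `r`
thus serves as the range minimum and as the number of the common ancestor. -/
theorem exists_isRMQ_lcp (S : List ℕ) {i j : ℕ} (hij : i ≤ j) (hj : j < S.length) :
    ∃ (r : ℕ) (u v : Node), IsRMQ S i j r ∧ (inorder (cartesianTree S))[i]? = some u ∧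
      (inorder (cartesianTree S))[j]? = some v ∧
      (inorder (cartesianTree S))[r]? = some (lcp u v) := by
  induction hn : S.length using Nat.strong_induction_on generalizing S i j with
  | _ n ih =>
    have h : S ≠ [] := by rintro rfl; simp at hj
    have hlt := minPos_lt h
    obtain ⟨hmin, hfirst⟩ := minPos_spec h
    have hlenL := length_inorder_cartesianTree (S.take (minPos S))
    have hlenR := length_inorder_cartesianTree (S.drop (minPos S + 1))
    rw [cartesianTree_cons h]
    simp only [inorder]
    set m := minPos S with hm
    have hlenL' : (inorder (cartesianTree (S.take m))).length = m := by
      rw [hlenL, List.length_take]; omega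
    have getL : ∀ k < m, ∀ u, (inorder (cartesianTree (S.take m)))[k]? = some u →
        ((inorder (cartesianTree (S.take m))).map (false :: ·) ++
          [] :: (inorder (cartesianTree (S.drop (m + 1)))).map (true :: ·))[k]?
          = some (false :: u) := by
      intro k hk u hu
      rw [List.getElem?_append_left (by simp; omega)]
      simp [hu]
    have getM : ((inorder (cartesianTree (S.take m))).map (false :: ·) ++
          [] :: (inorder (cartesianTree (S.drop (m + 1)))).map (true :: ·))[m]?
          = some [] := by
      rw [List.getElem?_append_right (by simp; omega)]
      simp [hlenL']
    have getR : ∀ k u, (inorder (cartesianTree (S.drop (m + 1))))[k]? = some u →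
        ((inorder (cartesianTree (S.take m))).map (false :: ·) ++
          [] :: (inorder (cartesianTree (S.drop (m + 1)))).map (true :: ·))[m + 1 + k]?
          = some (true :: u) := by
      intro k u hu
      rw [List.getElem?_append_right (by simp; omega)]
      simp only [List.length_map, hlenL']
      rw [show m + 1 + k - m = k + 1 by omega]
      simp [hu]
    have exL : ∀ k < m, ∃ u, (inorder (cartesianTree (S.take m)))[k]? = some u := fun k hk =>
      ⟨_, List.getElem?_eq_getElem (by omega)⟩
    have exR : ∀ k, m + 1 + k < S.length →
        ∃ u, (inorder (cartesianTree (S.drop (m + 1))))[k]? = some u := fun k hk =>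
      ⟨_, List.getElem?_eq_getElem (by rw [hlenR, List.length_drop]; omega)⟩
    rcases lt_or_ge j m with hjm | hjm
    · obtain ⟨r, u, v, ⟨h1, h2, h3, h4, h5⟩, hu, hv, hr⟩ := ih (S.take m).length
        (by simp; omega) (S.take m) hij (by simp; omega) rfl
      have hget : ∀ k, k ≤ j → (S.take m).getD k 0 = S.getD k 0 := by
        intro k hk
        simp [List.getD_eq_getElem?_getD, show k < m by omega]
      refine ⟨r, false :: u, false :: v, ⟨h1, h2, hj, ?_, ?_⟩, getL _ (by omega) _ hu,
        getL _ hjm _ hv, by simpa [lcp] using getL _ (by omega) _ hr⟩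
      · intro k hk hk'
        have := h4 k hk hk'
        rwa [hget _ h2, hget _ hk'] at this
      · intro k hk hk'
        have := h5 k hk hk'
        rwa [hget _ h2, hget _ (by omega)] at this
    · rcases le_or_gt i m with him | him
      · refine ⟨m, ?_⟩
        have hR : IsRMQ S i j m :=
          ⟨him, hjm, hj, fun k _ hk => hmin k (by omega), fun k _ hk => hfirst k hk⟩
        have hi : ∃ u, (u = [] ∨ ∃ u', u = false :: u') ∧
            ((inorder (cartesianTree (S.take m))).map (false :: ·) ++
          [] :: (inorder (cartesianTree (S.drop (m + 1)))).map (true :: ·))[i]? = some u := by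
          rcases him.eq_or_lt with rfl | him
          · exact ⟨_, .inl rfl, getM⟩
          · obtain ⟨u, hu⟩ := exL i him
            exact ⟨_, .inr ⟨u, rfl⟩, getL _ him _ hu⟩
        have hj' : ∃ u, (u = [] ∨ ∃ u', u = true :: u') ∧
            ((inorder (cartesianTree (S.take m))).map (false :: ·) ++
          [] :: (inorder (cartesianTree (S.drop (m + 1)))).map (true :: ·))[j]? = some u := by
          rcases hjm.eq_or_lt with hjm | hjm
          · exact ⟨_, .inl rfl, hjm ▸ getM⟩
          · obtain ⟨k, rfl⟩ : ∃ k, j = m + 1 + k := ⟨j - (m + 1), by omega⟩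
            obtain ⟨u, hu⟩ := exR k hj
            exact ⟨_, .inr ⟨u, rfl⟩, getR _ _ hu⟩
        obtain ⟨u, hu, hu'⟩ := hi
        obtain ⟨v, hv, hv'⟩ := hj'
        refine ⟨u, v, hR, hu', hv', ?_⟩
        rw [getM]
        rcases hu with rfl | ⟨u, rfl⟩ <;> rcases hv with rfl | ⟨v, rfl⟩ <;> simp [lcp]
      · obtain ⟨i, rfl⟩ : ∃ k, i = m + 1 + k := ⟨i - (m + 1), by omega⟩
        obtain ⟨j, rfl⟩ : ∃ k, j = m + 1 + k := ⟨j - (m + 1), by omega⟩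
        obtain ⟨r, u, v, ⟨h1, h2, h3, h4, h5⟩, hu, hv, hr⟩ := ih (S.drop (m + 1)).length
          (by simp; omega) (S.drop (m + 1)) (i := i) (j := j) (by omega) (by simp; omega) rfl
        have hget : ∀ k, (S.drop (m + 1)).getD k 0 = S.getD (m + 1 + k) 0 := by
          intro k
          simp [List.getD_eq_getElem?_getD, List.getElem?_drop]
        refine ⟨m + 1 + r, true :: u, true :: v, ⟨by omega, by omega, hj, ?_, ?_⟩, getR _ _ hu,
          getR _ _ hv, by simpa [lcp] using getR _ _ hr⟩
        · intro k hk hk'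
          obtain ⟨k, rfl⟩ : ∃ l, k = m + 1 + l := ⟨k - (m + 1), by omega⟩
          have := h4 k (by omega) (by omega)
          rwa [hget, hget] at this
        · intro k hk hk'
          obtain ⟨k, rfl⟩ : ∃ l, k = m + 1 + l := ⟨k - (m + 1), by omega⟩
          have := h5 k (by omega) (by omega)
          rwa [hget, hget] at this

/-- The longest common prefix of two nodes is their lowest common ancestor. -/
theorem isInorderLCA_of_lcp {T : BinaryTree Unit} {i j r : ℕ} {u v : Node}
    (hu : (inorder T)[i]? = some u) (hv : (inorder T)[j]? = some v)
    (hr : (inorder T)[r]? = some (lcp u v)) : IsInorderLCA T i j r :=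
  ⟨u, v, lcp u v, hu, hv, hr, List.mem_of_getElem? hr, lcp_prefix_left u v,
    lcp_comm v u ▸ lcp_prefix_left v u, fun _ _ h h' => prefix_lcp h h'⟩

/-! ### Ranks in finite sets of nodes -/

theorem rk_lt {F : Finset Node} {x y : Node} (hx : x ∈ F) (h : ilt x y = true) :
    rk F x < rk F y := by
  refine Finset.card_lt_card ((Finset.ssubset_iff_of_subset fun z hz => ?_).2 ⟨x, ?_, ?_⟩)
  · simp only [Finset.mem_filter] at hz ⊢
    exact ⟨hz.1, ilt_trans hz.2 h⟩
  · simp [hx, h]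
  · simp [ilt_irrefl]

theorem rk_lt_card {F : Finset Node} {x : Node} (hx : x ∈ F) : rk F x < F.card := by
  refine Finset.card_lt_card ((Finset.ssubset_iff_of_subset (Finset.filter_subset _ _)).2
    ⟨x, hx, ?_⟩)
  simp [ilt_irrefl]

theorem rk_lt_iff {F : Finset Node} {x y : Node} (hx : x ∈ F) (hy : y ∈ F) :
    rk F x < rk F y ↔ ilt x y = true := by
  refine ⟨fun h => ?_, rk_lt hx⟩
  rcases ilt_trichotomy x y with rfl | h' | h'
  · omega
  · exact h'
  · have := rk_lt hy h'
    omega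

theorem rk_eq_zero {F : Finset Node} {z : Node} (h : ∀ y ∈ F, ilt y z = false) : rk F z = 0 := by
  rw [rk, Finset.card_eq_zero, Finset.filter_eq_empty_iff]
  intro y hy
  simp [h y hy]

theorem rk_eq_card {F : Finset Node} {z : Node} (h : ∀ y ∈ F, ilt y z = true) :
    rk F z = F.card := by
  rw [rk, Finset.filter_true_of_mem h]

theorem rk_congr {F : Finset Node} {z u : Node} (h : ∀ y ∈ F, ilt y z = ilt y u) :
    rk F z = rk F u := by
  rw [rk, rk]
  congr 1
  exact Finset.filter_congr fun y hy => by rw [h y hy]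

theorem rk_erase_self (F : Finset Node) (u : Node) : rk (F.erase u) u = rk F u := by
  rw [rk, rk]
  congr 1
  ext y
  simp only [Finset.mem_filter, Finset.mem_erase]
  exact ⟨fun h => ⟨h.1.2, h.2⟩, fun h => ⟨⟨ilt_ne h.2, h.1⟩, h.2⟩⟩

theorem rk_union {A B : Finset Node} {u : Node} (h : A ∩ B = {u}) (z : Node) :
    rk (A ∪ B) z = rk A z + rk (B.erase u) z := by
  have hu : u ∈ A := (Finset.mem_inter.1 (h ▸ Finset.mem_singleton_self u)).1
  have hset : A ∪ B = A ∪ B.erase u := by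
    ext y
    by_cases hy : y = u
    · simp [hy, hu]
    · simp [hy]
  rw [hset, rk, rk, rk, Finset.filter_union, Finset.card_union_of_disjoint]
  refine Finset.disjoint_filter_filter (Finset.disjoint_left.2 fun y hy hy' => ?_)
  rw [Finset.mem_erase] at hy'
  exact hy'.1 (Finset.mem_singleton.1 (h ▸ Finset.mem_inter.2 ⟨hy, hy'.2⟩))

theorem rk_union' {A B : Finset Node} {u : Node} (h : A ∩ B = {u}) (z : Node) :
    rk (A ∪ B) z = rk (A.erase u) z + rk B z := by
  rw [Finset.union_comm, rk_union (by rwa [Finset.inter_comm]), add_comm]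

theorem card_union_add_one {A B : Finset Node} {u : Node} (h : A ∩ B = {u}) :
    (A ∪ B).card + 1 = A.card + B.card := by
  rw [← Finset.card_union_add_card_inter, h, Finset.card_singleton]

/-- `B` hangs below the node `u`, which has no proper descendants in `A`. -/
structure Hangs (A B : Finset Node) (u : Node) : Prop where
  inter : A ∩ B = {u}
  leaf : ∀ x ∈ A, u <+: x → x = u
  below : ∀ x ∈ B, u <+: x

namespace Hangs

variable {A B : Finset Node} {u : Node}

theorem left_mem (h : Hangs A B u) : u ∈ A :=
  (Finset.mem_inter.1 (h.inter ▸ Finset.mem_singleton_self u)).1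

theorem right_mem (h : Hangs A B u) : u ∈ B :=
  (Finset.mem_inter.1 (h.inter ▸ Finset.mem_singleton_self u)).2

theorem not_prefix (h : Hangs A B u) {z : Node} (hz : z ∈ A) (hzu : z ≠ u) : ¬ u <+: z :=
  fun hp => hzu (h.leaf z hz hp)

theorem card_erase (h : Hangs A B u) : (B.erase u).card = B.card - 1 :=
  Finset.card_erase_of_mem h.right_mem

/-- Seen from a node of `A` other than `u`, all of `B` lies on the same side as `u`. So adding `B`
changes the rank by nothing here, and by the number of its nodes other than `u` in `rk_of_gt`. -/
theorem rk_of_lt (h : Hangs A B u) {z : Node} (hz : z ∈ A) (hzu : ilt z u = true) :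
    rk (A ∪ B) z = rk A z := by
  rw [rk_union h.inter, rk_eq_zero (F := B.erase u), add_zero]
  intro y hy
  rw [ilt_left_of_prefix (h.below y (Finset.mem_of_mem_erase hy))
    (h.not_prefix hz (ilt_ne hzu)), ilt_asymm hzu]

theorem rk_of_gt (h : Hangs A B u) {z : Node} (hz : z ∈ A) (hzu : ilt u z = true) :
    rk (A ∪ B) z = rk A z + (B.card - 1) := by
  rw [rk_union h.inter, rk_eq_card (F := B.erase u), h.card_erase]
  intro y hy
  rw [ilt_left_of_prefix (h.below y (Finset.mem_of_mem_erase hy))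
    (h.not_prefix hz (ilt_ne hzu).symm), hzu]

/-- For the nodes of `A` other than `u`, preceding `z` is the same as preceding `u`. -/
theorem rk_right (h : Hangs A B u) {z : Node} (hz : z ∈ B) :
    rk (A ∪ B) z = rk A u + rk B z := by
  rw [rk_union' h.inter, ← rk_erase_self A u]
  congr 1
  refine rk_congr fun y hy => ?_
  rw [Finset.mem_erase] at hy
  exact ilt_right_of_prefix (h.below z hz) (h.not_prefix hy.2 hy.1)

end Hangs

/-- `L` and `R` have the node `v` in common, which comes after all others of `L` and before all
others of `R`. -/
structure Splits (L R : Finset Node) (v : Node) : Prop where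
  inter : L ∩ R = {v}
  left : ∀ x ∈ L, x = v ∨ ilt x v = true
  right : ∀ x ∈ R, x = v ∨ ilt v x = true

namespace Splits

variable {L R : Finset Node} {v : Node}

theorem left_mem (h : Splits L R v) : v ∈ L :=
  (Finset.mem_inter.1 (h.inter ▸ Finset.mem_singleton_self v)).1

theorem right_mem (h : Splits L R v) : v ∈ R :=
  (Finset.mem_inter.1 (h.inter ▸ Finset.mem_singleton_self v)).2

theorem lt_of_left_of_right (h : Splits L R v) {x y : Node} (hx : x ∈ L) (hy : y ∈ R)
    (hne : x ≠ v ∨ y ≠ v) : ilt x y = true := by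
  rcases h.left x hx with rfl | hx'
  · exact (h.right y hy).resolve_left (hne.resolve_left fun h => h rfl)
  · rcases h.right y hy with rfl | hy'
    · exact hx'
    · exact ilt_trans hx' hy'

theorem rk_left (h : Splits L R v) {z : Node} (hz : z ∈ L) : rk (L ∪ R) z = rk L z := by
  rw [rk_union h.inter, rk_eq_zero (F := R.erase v), add_zero]
  intro y hy
  rw [Finset.mem_erase] at hy
  exact ilt_asymm (h.lt_of_left_of_right hz hy.2 (.inr hy.1))

theorem rk_left_top (h : Splits L R v) : rk L v = L.card - 1 := by
  rw [← rk_erase_self, rk_eq_card, Finset.card_erase_of_mem h.left_mem]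
  intro y hy
  rw [Finset.mem_erase] at hy
  exact (h.left y hy.2).resolve_left hy.1

theorem rk_right_top (h : Splits L R v) : rk R v = 0 := by
  refine rk_eq_zero fun y hy => ?_
  rcases h.right y hy with rfl | hy
  · exact ilt_irrefl _
  · exact ilt_asymm hy

theorem rk_right (h : Splits L R v) {z : Node} (hz : z ∈ R) :
    rk (L ∪ R) z = rk L v + rk R z := by
  rw [rk_union' h.inter, rk_eq_card, h.rk_left_top, Finset.card_erase_of_mem h.left_mem]
  intro y hy
  rw [Finset.mem_erase] at hy
  exact h.lt_of_left_of_right hy.2 hz (.inl hy.1)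

end Splits

/-! ### Decompositions into finite sets of nodes -/

/-- The number of nodes of a cluster of shape `τ`. -/
def size : TopTree → ℕ
  | .edge _ => 2
  | .merge _ a b => size a + size b - 1

/-- The ranks of the top and of the (possible) bottom boundary node in a cluster of shape `τ`. -/
def boundaryRanks : TopTree → ℕ × ℕ
  | .edge b => if b then (0, 1) else (1, 0)
  | .merge .vertical a b =>
      (if (boundaryRanks a).1 < (boundaryRanks a).2 then (boundaryRanks a).1
        else (boundaryRanks a).1 + (size b - 1),
      (boundaryRanks a).2 + (boundaryRanks b).2)
  | .merge .horizontalLeft a b =>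
      ((boundaryRanks a).1 + (boundaryRanks b).1, (boundaryRanks a).2 + (boundaryRanks b).1)
  | .merge .horizontalRight a b =>
      ((boundaryRanks a).1 + (boundaryRanks b).1, (boundaryRanks b).2 + (boundaryRanks a).1)
  | .merge .horizontalNone a b => ((boundaryRanks a).1 + (boundaryRanks b).1, 0)

/-- The rank of the top boundary node. -/
def topRank (τ : TopTree) : ℕ := (boundaryRanks τ).1

/-- The rank of the bottom boundary node, if there is one. -/
def bottomRank (τ : TopTree) : ℕ := (boundaryRanks τ).2

/-- The bottom boundary node of a horizontal merge. -/
def HorizontalBottom : MergeType → Option Node → Option Node → Option Node → Prop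
  | .vertical, _, _, _ => False
  | .horizontalLeft, p, q, r => q = none ∧ r = p
  | .horizontalRight, p, q, r => p = none ∧ r = q
  | .horizontalNone, p, q, r => p = none ∧ q = none ∧ r = none

/-- A version of `Decomposes` with finite sets of nodes. -/
inductive Shape : TopTree → Finset Node → Node → Option Node → Prop
  | edge (v : Node) (b : Bool) (bot : Option Node) (h : ∀ u ∈ bot, u = v ++ [b]) :
      Shape (.edge b) {v, v ++ [b]} v bot
  | vertical {a b : TopTree} {A B : Finset Node} {v u : Node} {bot : Option Node}
      (hA : Shape a A v (some u)) (hB : Shape b B u bot) (h : A ∩ B = {u}) :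
      Shape (.merge .vertical a b) (A ∪ B) v bot
  | horizontal {a b : TopTree} {A B : Finset Node} {v : Node} {botA botB bot : Option Node}
      (m : MergeType) (hA : Shape a A v botA) (hB : Shape b B v botB) (h : A ∩ B = {v})
      (hm : HorizontalBottom m botA botB bot) :
      Shape (.merge m a b) (A ∪ B) v bot

theorem Decomposes.exists_shape {T : BinaryTree Unit} {τ : TopTree} {C : Cluster}
    (h : Decomposes T τ C) : ∃ F : Finset Node, ↑F = C.carrier ∧ Shape τ F C.top C.bottom := by
  induction h with
  | edgeLeaf v b => exact ⟨{v, v ++ [b]}, by simp, .edge v b _ (by simp)⟩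
  | edgeInner v b => exact ⟨{v, v ++ [b]}, by simp, .edge v b _ (by simp)⟩
  | @vertical a b A B _ _ hbd hinter _ ihA ihB =>
    obtain ⟨F, hF, hSF⟩ := ihA
    obtain ⟨G, hG, hSG⟩ := ihB
    rw [hbd] at hSF
    rw [← hF, ← hG] at hinter
    exact ⟨F ∪ G, by simp [hF, hG], .vertical hSF hSG (by exact_mod_cast hinter)⟩
  | @horizontalLeft a b A B _ _ htop hinter u hbA hbB _ ihA ihB =>
    obtain ⟨F, hF, hSF⟩ := ihA
    obtain ⟨G, hG, hSG⟩ := ihB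
    rw [← htop] at hSG
    rw [← hF, ← hG] at hinter
    exact ⟨F ∪ G, by simp [hF, hG], .horizontal _ hSF hSG (by exact_mod_cast hinter)
      ⟨hbB, hbA.symm⟩⟩
  | @horizontalRight a b A B _ _ htop hinter u hbA hbB _ ihA ihB =>
    obtain ⟨F, hF, hSF⟩ := ihA
    obtain ⟨G, hG, hSG⟩ := ihB
    rw [← htop] at hSG
    rw [← hF, ← hG] at hinter
    exact ⟨F ∪ G, by simp [hF, hG], .horizontal _ hSF hSG (by exact_mod_cast hinter)
      ⟨hbA, hbB.symm⟩⟩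
  | @horizontalNone a b A B _ _ htop hinter hbA hbB _ ihA ihB =>
    obtain ⟨F, hF, hSF⟩ := ihA
    obtain ⟨G, hG, hSG⟩ := ihB
    rw [← htop] at hSG
    rw [← hF, ← hG] at hinter
    exact ⟨F ∪ G, by simp [hF, hG], .horizontal _ hSF hSG (by exact_mod_cast hinter)
      ⟨hbA, hbB, rfl⟩⟩

/-- The structural properties of a cluster. -/
structure IsPiece (F : Finset Node) (v : Node) (bot : Option Node) : Prop where
  top_mem : v ∈ F
  below : ∀ x ∈ F, v <+: x
  convex : ∀ x ∈ F, ∀ z, v <+: z → z <+: x → z ∈ F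
  nontrivial : ∃ x ∈ F, x ≠ v
  bottom_mem : ∀ u ∈ bot, u ∈ F
  bottom_ne : ∀ u ∈ bot, u ≠ v
  bottom_leaf : ∀ u ∈ bot, ∀ x ∈ F, u <+: x → x = u

namespace IsPiece

variable {A B : Finset Node} {v u : Node} {botA botB bot : Option Node}

theorem hangs (hA : IsPiece A v (some u)) (hB : IsPiece B u bot) (h : A ∩ B = {u}) :
    Hangs A B u :=
  ⟨h, hA.bottom_leaf u rfl, hB.below⟩

theorem exists_child (hA : IsPiece A v bot) : ∃ c, v ++ [c] ∈ A := by
  obtain ⟨x, hx, hne⟩ := hA.nontrivial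
  obtain ⟨w, rfl⟩ := hA.below x hx
  rcases w with _ | ⟨c, w⟩
  · simp at hne
  · exact ⟨c, hA.convex _ hx _ (List.prefix_append _ _) ⟨w, by simp⟩⟩

theorem child_prefix (hA : IsPiece A v bot) {c : Bool} (hc : v ++ [!c] ∉ A) {x : Node}
    (hx : x ∈ A) (hne : x ≠ v) : v ++ [c] <+: x := by
  obtain ⟨w, rfl⟩ := hA.below x hx
  rcases w with _ | ⟨d, w⟩
  · simp at hne
  · have hd := hA.convex _ hx (v ++ [d]) (List.prefix_append _ _) ⟨w, by simp⟩
    by_cases hcd : d = c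
    · subst hcd
      exact ⟨w, by simp⟩
    · have : d = !c := by cases c <;> cases d <;> simp_all
      exact absurd (this ▸ hd) hc

theorem vertical (hA : IsPiece A v (some u)) (hB : IsPiece B u bot) (h : A ∩ B = {u}) :
    IsPiece (A ∪ B) v bot := by
  have hvu : v <+: u := hA.below u (hA.bottom_mem u rfl)
  refine ⟨by simp [hA.top_mem], ?_, ?_, ?_, ?_, ?_, ?_⟩
  · intro x hx
    rcases Finset.mem_union.1 hx with hx | hx
    · exact hA.below x hx
    · exact hvu.trans (hB.below x hx)
  · intro x hx z hvz hzx
    rcases Finset.mem_union.1 hx with hx | hx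
    · exact Finset.mem_union_left _ (hA.convex x hx z hvz hzx)
    · rcases List.prefix_or_prefix_of_prefix hzx (hB.below x hx) with hzu | huz
      · exact Finset.mem_union_left _ (hA.convex u (hA.bottom_mem u rfl) z hvz hzu)
      · exact Finset.mem_union_right _ (hB.convex x hx z huz hzx)
  · exact ⟨u, Finset.mem_union_left _ (hA.bottom_mem u rfl), hA.bottom_ne u rfl⟩
  · exact fun w hw => Finset.mem_union_right _ (hB.bottom_mem w hw)
  · rintro w hw rfl
    have := hB.below w (hB.bottom_mem w hw)
    exact hA.bottom_ne u rfl (this.eq_of_length_le hvu.length_le)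
  · intro w hw x hx hwx
    rcases Finset.mem_union.1 hx with hx | hx
    · have huw := hB.below w (hB.bottom_mem w hw)
      have hxu := hA.bottom_leaf u rfl x hx (huw.trans hwx)
      subst hxu
      exact huw.eq_of_length_le hwx.length_le
    · exact hB.bottom_leaf w hw x hx hwx

/-- Each piece contains a child of `v`, by convexity and nontriviality, and the two children differ
because only `v` is shared. As there are only two children, each piece lies, apart from `v`, below
its own one. -/
theorem exists_distinct_children (hA : IsPiece A v botA) (hB : IsPiece B v botB)
    (h : A ∩ B = {v}) :
    ∃ c, (∀ x ∈ A, x ≠ v → v ++ [c] <+: x) ∧ ∀ x ∈ B, x ≠ v → v ++ [!c] <+: x := by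
  obtain ⟨c, hc⟩ := hA.exists_child
  obtain ⟨d, hd⟩ := hB.exists_child
  have key : ∀ e, v ++ [e] ∈ A → v ++ [e] ∉ B := by
    intro e h1 h2
    have := Finset.mem_singleton.1 (h ▸ Finset.mem_inter.2 ⟨h1, h2⟩)
    simp at this
  have hcd : d = !c := by
    have : d ≠ c := by
      rintro rfl
      exact key _ hc hd
    cases c <;> cases d <;> simp_all
  subst hcd
  refine ⟨c, fun x hx => hA.child_prefix (fun h' => key _ h' hd) hx,
    fun x hx => hB.child_prefix (c := !c) ?_ hx⟩
  rw [Bool.not_not]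
  exact key _ hc

theorem splits (hA : IsPiece A v botA) (hB : IsPiece B v botB) (h : A ∩ B = {v}) :
    Splits A B v ∨ Splits B A v := by
  obtain ⟨c, h1, h2⟩ := hA.exists_distinct_children hB h
  cases c
  · refine .inl ⟨h, fun x hx => ?_, fun x hx => ?_⟩
    · exact or_iff_not_imp_left.2 fun hne => (ilt_iff_self (hA.below x hx)).2 (h1 x hx hne)
    · exact or_iff_not_imp_left.2 fun hne => (ilt_self_iff (hB.below x hx)).2 (h2 x hx hne)
  · refine .inr ⟨by rwa [Finset.inter_comm], fun x hx => ?_, fun x hx => ?_⟩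
    · exact or_iff_not_imp_left.2 fun hne => (ilt_iff_self (hB.below x hx)).2 (h2 x hx hne)
    · exact or_iff_not_imp_left.2 fun hne => (ilt_self_iff (hA.below x hx)).2 (h1 x hx hne)

/-- The two pieces lie below different children of `v`. It ensures that the bottom boundary node of
one part has no proper descendant in the other part. -/
theorem not_prefix_of_bottom (hA : IsPiece A v botA) (hB : IsPiece B v botB) (h : A ∩ B = {v})
    {u x : Node} (hu : u ∈ A) (hne : u ≠ v) (hx : x ∈ B) : ¬ u <+: x := by
  intro hux
  obtain ⟨c, h1, h2⟩ := hA.exists_distinct_children hB h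
  by_cases hxv : x = v
  · subst hxv
    exact hne ((hA.below u hu).eq_of_length_le hux.length_le).symm
  · have := List.prefix_of_prefix_length_le ((h1 u hu hne).trans hux) (h2 x hx hxv) (by simp)
    have := this.eq_of_length (by simp)
    simp at this

theorem horizontal (hA : IsPiece A v botA) (hB : IsPiece B v botB) (h : A ∩ B = {v})
    (hbot : bot = none ∨ bot = botA ∨ bot = botB) : IsPiece (A ∪ B) v bot := by
  refine ⟨by simp [hA.top_mem], ?_, ?_, ?_, ?_, ?_, ?_⟩
  · intro x hx
    rcases Finset.mem_union.1 hx with hx | hx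
    · exact hA.below x hx
    · exact hB.below x hx
  · intro x hx z hvz hzx
    rcases Finset.mem_union.1 hx with hx | hx
    · exact Finset.mem_union_left _ (hA.convex x hx z hvz hzx)
    · exact Finset.mem_union_right _ (hB.convex x hx z hvz hzx)
  · obtain ⟨x, hx, hne⟩ := hA.nontrivial
    exact ⟨x, Finset.mem_union_left _ hx, hne⟩
  · intro u hu
    rcases hbot with rfl | rfl | rfl
    · simp at hu
    · exact Finset.mem_union_left _ (hA.bottom_mem u hu)
    · exact Finset.mem_union_right _ (hB.bottom_mem u hu)
  · intro u hu
    rcases hbot with rfl | rfl | rfl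
    · simp at hu
    · exact hA.bottom_ne u hu
    · exact hB.bottom_ne u hu
  · intro u hu x hx hux
    rcases hbot with rfl | rfl | rfl
    · simp at hu
    · rcases Finset.mem_union.1 hx with hx | hx
      · exact hA.bottom_leaf u hu x hx hux
      · exact absurd hux (hA.not_prefix_of_bottom hB h (hA.bottom_mem u hu)
          (hA.bottom_ne u hu) hx)
    · rcases Finset.mem_union.1 hx with hx | hx
      · exact absurd hux (hB.not_prefix_of_bottom hA (by rwa [Finset.inter_comm])
          (hB.bottom_mem u hu) (hB.bottom_ne u hu) hx)
      · exact hB.bottom_leaf u hu x hx hux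

end IsPiece

theorem HorizontalBottom.cases {m : MergeType} {p q r : Option Node}
    (h : HorizontalBottom m p q r) : r = none ∨ r = p ∨ r = q := by
  cases m <;> simp_all [HorizontalBottom]

theorem Shape.isPiece {τ : TopTree} {F : Finset Node} {v : Node} {bot : Option Node}
    (h : Shape τ F v bot) : IsPiece F v bot := by
  induction h with
  | edge v b bot h =>
    refine ⟨by simp, by simp, ?_, ⟨v ++ [b], by simp⟩, ?_, ?_, ?_⟩
    · intro x hx z hvz hzx
      simp only [Finset.mem_insert, Finset.mem_singleton] at hx ⊢
      rcases hx with rfl | rfl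
      · exact .inl (hzx.eq_of_length_le hvz.length_le)
      · rcases List.prefix_concat_iff.1 hzx with rfl | hzx
        · exact .inr rfl
        · exact .inl (hzx.eq_of_length_le hvz.length_le)
    · intro u hu
      simp [h u hu]
    · intro u hu
      simp [h u hu]
    · intro u hu x hx hux
      rw [h u hu] at hux ⊢
      simp only [Finset.mem_insert, Finset.mem_singleton] at hx
      rcases hx with rfl | rfl
      · have := hux.length_le
        simp at this
      · rfl
  | vertical _ _ h ihA ihB => exact ihA.vertical ihB h
  | horizontal m _ _ h hm ihA ihB => exact ihA.horizontal ihB h hm.cases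

theorem two_le_size (τ : TopTree) : 2 ≤ size τ := by
  induction τ with
  | edge b => simp [size]
  | merge m a b iha ihb => simp only [size]; omega

/-- Arithmetic on all shapes, whether or not they come from clusters: even when there is no bottom
boundary node, the default value of `bottomRank` is small enough to fit into a word. -/
theorem boundaryRanks_lt_size (τ : TopTree) : topRank τ < size τ ∧ bottomRank τ < size τ := by
  induction τ with
  | edge b => cases b <;> simp [size, topRank, bottomRank, boundaryRanks]
  | merge m a b iha ihb =>
    simp only [topRank, bottomRank] at *
    cases m <;> simp only [boundaryRanks, size]
    · split_ifs <;> omega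
    all_goals omega

/-- The right-hand sides do not mention `F` or `v`: this is why one record can serve all occurrences
of a shared subtree. -/
theorem Shape.ranks {τ : TopTree} {F : Finset Node} {v : Node} {bot : Option Node}
    (h : Shape τ F v bot) :
    F.card = size τ ∧ rk F v = topRank τ ∧ ∀ u ∈ bot, rk F u = bottomRank τ := by
  induction h with
  | edge v b bot h =>
    have h0 := ilt_append v [] [b]
    have h1 := ilt_append v [b] []
    rw [List.append_nil] at h0 h1
    refine ⟨?_, ?_, ?_⟩
    · rw [Finset.card_pair (by simp)]
      rfl
    · cases b <;> simp [rk, Finset.filter_insert, Finset.filter_singleton, h1, ilt_irrefl, ilt,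
        topRank, boundaryRanks]
    · intro u hu
      rw [h u hu]
      cases b <;> simp [rk, Finset.filter_insert, Finset.filter_singleton, h0, ilt_irrefl, ilt,
        bottomRank, boundaryRanks]
  | @vertical a b A B v u bot hA hB h ihA ihB =>
    have hh := hA.isPiece.hangs hB.isPiece h
    have hcard := card_union_add_one h
    obtain ⟨cA, tA, bA⟩ := ihA
    obtain ⟨cB, tB, bB⟩ := ihB
    have bA := bA u rfl
    have hvA := hA.isPiece.top_mem
    have huA := hA.isPiece.bottom_mem u rfl
    refine ⟨?_, ?_, ?_⟩
    · simp only [size]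
      omega
    · change _ = if topRank a < bottomRank a then topRank a else topRank a + (size b - 1)
      rw [← tA, ← bA, ← cB]
      split_ifs with hlt
      · exact hh.rk_of_lt hvA ((rk_lt_iff hvA huA).1 hlt)
      · refine hh.rk_of_gt hvA ?_
        rcases ilt_trichotomy u v with huv | huv | huv
        · exact absurd huv (hA.isPiece.bottom_ne u rfl)
        · exact huv
        · exact absurd (rk_lt hvA huv) hlt
    · intro w hw
      change _ = bottomRank a + bottomRank b
      rw [hh.rk_right (hB.isPiece.bottom_mem w hw), bA, bB w hw]
  | @horizontal a b A B v botA botB bot m hA hB h hm ihA ihB =>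
    have hcard := card_union_add_one h
    obtain ⟨cA, tA, bA⟩ := ihA
    obtain ⟨cB, tB, bB⟩ := ihB
    -- The top has rank 0 in the right part, and in the left part its rank is the number of nodes
    -- preceding it. Adding the top rank of the other part is therefore correct whichever of `A` and
    -- `B` is on the left.
    have hrk : (∀ z ∈ A, rk (A ∪ B) z = rk A z + topRank b) ∧
        ∀ z ∈ B, rk (A ∪ B) z = rk B z + topRank a := by
      rcases hA.isPiece.splits hB.isPiece h with hs | hs
      · have := hs.rk_right_top
        refine ⟨fun z hz => ?_, fun z hz => ?_⟩
        · rw [hs.rk_left hz]; omega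
        · rw [hs.rk_right hz]; omega
      · have := hs.rk_right_top
        rw [Finset.union_comm]
        refine ⟨fun z hz => ?_, fun z hz => ?_⟩
        · rw [hs.rk_right hz]; omega
        · rw [hs.rk_left hz]; omega
    refine ⟨?_, ?_, ?_⟩
    · simp only [size]
      omega
    · have : topRank (.merge m a b) = topRank a + topRank b := by
        cases m
        · simp [HorizontalBottom] at hm
        all_goals rfl
      rw [this, hrk.1 v hA.isPiece.top_mem, tA]
    · intro u hu
      cases m
      · simp [HorizontalBottom] at hm
      · obtain ⟨_, rfl⟩ := hm
        rw [hrk.1 u (hA.isPiece.bottom_mem u hu), bA u hu]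
        rfl
      · obtain ⟨_, rfl⟩ := hm
        rw [hrk.2 u (hB.isPiece.bottom_mem u hu), bB u hu]
        rfl
      · simp [hm.2.2] at hu

/-! ### The state of a query at a cluster -/

/-- The state of a query at a cluster: `i < j` are ranks of nodes of the cluster with longest
common prefix `goal`; the global rank `G` of a node before (after) the bottom boundary node is
its rank in the cluster increased by `a` (by `b`); `g` is the global rank of the top boundary
node. -/
structure QueryState (N : ℕ) (G : Node → ℕ) (goal : Node) (F : Finset Node) (v : Node)
    (bot : Option Node) (i j a b g : ℕ) : Prop where
  query : ∃ x ∈ F, ∃ y ∈ F, ilt x y = true ∧ rk F x = i ∧ rk F y = j ∧ lcp x y = goal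
  before : ∀ z ∈ F, (∀ u ∈ bot, ilt z u = true) → G z = rk F z + a
  after : ∀ z ∈ F, (∀ u ∈ bot, ilt u z = true) → G z = rk F z + b
  top : g = G v
  before_le : a + F.card ≤ N
  after_le : b + F.card ≤ N

namespace QueryState

variable {N : ℕ} {G : Node → ℕ} {goal v u : Node} {F A B L R : Finset Node}
  {bot botL botR : Option Node} {i j a b g : ℕ}

theorem lt (h : QueryState N G goal F v bot i j a b g) : i < j ∧ j < F.card := by
  obtain ⟨x, hx, y, hy, hxy, rfl, rfl, -⟩ := h.query
  exact ⟨rk_lt hx hxy, rk_lt_card hy⟩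

theorem answer (h : QueryState N G goal F v bot i j a b g) (hF : IsPiece F v bot)
    (hi : i ≤ rk F v) (hj : rk F v ≤ j) : G goal = g := by
  obtain ⟨x, hx, y, hy, hxy, rfl, rfl, rfl⟩ := h.query
  rw [h.top, lcp_between (hF.below x hx) (hF.below y hy) _ _ hxy]
  · by_contra hlt
    have := rk_lt hF.top_mem (Bool.eq_true_of_not_eq_false hlt)
    omega
  · by_contra hlt
    have := rk_lt hy (Bool.eq_true_of_not_eq_false hlt)
    omega

/-- The flag `f` says on which side of the bottom boundary node the top lies, and so which offset
applies to it. Without a bottom boundary node both offsets are valid, so the value of `f` does not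
matter. -/
theorem top_eq (h : QueryState N G goal F v bot i j a b g) (hF : IsPiece F v bot) (f : ℕ)
    (hf : ∀ u ∈ bot, f = 0 ↔ rk F v < rk F u) : g = rk F v + if f = 0 then a else b := by
  rw [h.top]
  split_ifs with h0
  · exact h.before v hF.top_mem fun u hu =>
      (rk_lt_iff hF.top_mem (hF.bottom_mem u hu)).1 ((hf u hu).1 h0)
  · refine h.after v hF.top_mem fun u hu => ?_
    rcases ilt_trichotomy u v with huv | huv | huv
    · exact absurd huv (hF.bottom_ne u hu)
    · exact huv
    · exact absurd ((hf u hu).2 (rk_lt hF.top_mem huv)) h0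

/-- The rank in the upper cluster of a vertical merge of the node with rank `k`, respectively of
the bottom boundary node `p` if the node belongs to the lower cluster (with `s + 1` nodes). -/
def collapse (p s k : ℕ) : ℕ := if k < p then k else if k ≤ p + s then p else k - s

/-- In the inorder of `A ∪ B`, the nodes of `B` fill exactly the interval of ranks from `rk A u` to
`rk A u + (B.card - 1)`, so comparisons of ranks decide membership in `B`. -/
theorem exists_collapse (hh : Hangs A B u) {x : Node} (hx : x ∈ A ∪ B) :
    (x ∈ B ∧ rk A u ≤ rk (A ∪ B) x ∧ rk (A ∪ B) x ≤ rk A u + (B.card - 1) ∧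
      collapse (rk A u) (B.card - 1) (rk (A ∪ B) x) = rk A u) ∨
    (x ∈ A ∧ x ≠ u ∧ (rk (A ∪ B) x < rk A u ∨ rk A u + (B.card - 1) < rk (A ∪ B) x) ∧
      collapse (rk A u) (B.card - 1) (rk (A ∪ B) x) = rk A x) := by
  by_cases hxB : x ∈ B
  · have h1 := hh.rk_right hxB
    have h2 := rk_lt_card hxB
    refine .inl ⟨hxB, by omega, by omega, ?_⟩
    rw [collapse, if_neg (by omega), if_pos (by omega)]
  · have hxA : x ∈ A := (Finset.mem_union.1 hx).resolve_right hxB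
    have hne : x ≠ u := by rintro rfl; exact hxB hh.right_mem
    refine .inr ⟨hxA, hne, ?_⟩
    rcases ilt_trichotomy x u with hxu | hxu | hxu
    · exact absurd hxu hne
    · have h1 := hh.rk_of_lt hxA hxu
      have h2 := rk_lt hxA hxu
      refine ⟨by omega, ?_⟩
      rw [collapse, if_pos (by omega), h1]
    · have h1 := hh.rk_of_gt hxA hxu
      have h2 := rk_lt hh.left_mem hxu
      refine ⟨by omega, ?_⟩
      rw [collapse, if_neg (by omega), if_neg (by omega), h1]
      omega

/-- The bottom boundary node is that of `B`, and every rank in `B` is smaller by `rk A u` than in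
the union; hence both offsets grow by this amount. The last argument of the state is the global rank
of `u`, the new top. -/
theorem inner (h : QueryState N G goal (A ∪ B) v bot i j a b g) (hh : Hangs A B u)
    (hB : IsPiece B u bot) (hi : rk A u ≤ i) (hj : j ≤ rk A u + (B.card - 1)) (f : ℕ)
    (hf : ∀ w ∈ bot, f = 0 ↔ rk B u < rk B w) :
    QueryState N G goal B u bot (i - rk A u) (j - rk A u) (a + rk A u) (b + rk A u)
      (rk B u + if f = 0 then a + rk A u else b + rk A u) := by
  have hcard := card_union_add_one hh.inter
  have hu := rk_lt_card hh.left_mem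
  have key : QueryState N G goal B u bot (i - rk A u) (j - rk A u) (a + rk A u) (b + rk A u)
      (G u) := by
    refine ⟨?_, ?_, ?_, rfl, by have := h.before_le; omega, by have := h.after_le; omega⟩
    · obtain ⟨x, hx, y, hy, hxy, rfl, rfl, hgoal⟩ := h.query
      have hlt := rk_lt hx hxy
      have hxB : x ∈ B := by
        rcases exists_collapse hh hx with h' | h'
        · exact h'.1
        · omega
      have hyB : y ∈ B := by
        rcases exists_collapse hh hy with h' | h'
        · exact h'.1
        · omega
      refine ⟨x, hxB, y, hyB, hxy, ?_, ?_, hgoal⟩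
      · rw [hh.rk_right hxB]; omega
      · rw [hh.rk_right hyB]; omega
    · intro z hz hzu
      rw [h.before z (Finset.mem_union_right _ hz) hzu, hh.rk_right hz]
      omega
    · intro z hz hzu
      rw [h.after z (Finset.mem_union_right _ hz) hzu, hh.rk_right hz]
      omega
  rw [← key.top_eq hB f hf]
  exact key

/-- The old bottom boundary node, if any, lies in `B` and thus below `u`, so a node of `A` is before
or after it exactly as it is before or after `u`. Nodes after `u` lose the `B.card - 1` nodes of `B`
from their rank, which the second offset makes up for. -/
theorem outer (h : QueryState N G goal (A ∪ B) v bot i j a b g) (hh : Hangs A B u)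
    (hbot : ∀ w ∈ bot, w ∈ B)
    (hij : ¬ (rk A u ≤ i ∧ j ≤ rk A u + (B.card - 1))) :
    QueryState N G goal A v (some u) (collapse (rk A u) (B.card - 1) i)
      (collapse (rk A u) (B.card - 1) j) a (b + (B.card - 1)) g := by
  have hcard := card_union_add_one hh.inter
  have hBpos := Finset.card_pos.2 ⟨u, hh.right_mem⟩
  have hApos := Finset.card_pos.2 ⟨u, hh.left_mem⟩
  refine ⟨?_, ?_, ?_, h.top, by have := h.before_le; omega, by have := h.after_le; omega⟩
  · obtain ⟨x, hx, y, hy, hxy, rfl, rfl, hgoal⟩ := h.query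
    have hlt := rk_lt hx hxy
    rcases exists_collapse hh hx with ⟨hxB, hx1, hx2, hx3⟩ | ⟨hxA, hxu, hx2, hx3⟩ <;>
      rcases exists_collapse hh hy with ⟨hyB, hy1, hy2, hy3⟩ | ⟨hyA, hyu, hy2, hy3⟩
    -- Both query nodes in `B`: excluded by `hij`.
    · omega
    · refine ⟨u, hh.left_mem, y, hyA, ?_, hx3.symm, hy3.symm, ?_⟩
      · rw [← ilt_left_of_prefix (hh.below x hxB) (hh.not_prefix hyA hyu), hxy]
      · rw [← hgoal, lcp_comm x, lcp_right_of_prefix (hh.below x hxB) (hh.not_prefix hyA hyu),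
          lcp_comm]
    · refine ⟨x, hxA, u, hh.left_mem, ?_, hx3.symm, hy3.symm, ?_⟩
      · rw [← ilt_right_of_prefix (hh.below y hyB) (hh.not_prefix hxA hxu), hxy]
      · rw [← hgoal, lcp_right_of_prefix (hh.below y hyB) (hh.not_prefix hxA hxu)]
    · exact ⟨x, hxA, y, hyA, hxy, hx3.symm, hy3.symm, hgoal⟩
  · intro z hz hzu
    have hzu := hzu u rfl
    rw [h.before z (Finset.mem_union_left _ hz), hh.rk_of_lt hz hzu]
    intro w hw
    rwa [ilt_right_of_prefix (hh.below w (hbot w hw)) (hh.not_prefix hz (ilt_ne hzu))]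
  · intro z hz hzu
    have hzu := hzu u rfl
    rw [h.after z (Finset.mem_union_left _ hz), hh.rk_of_gt hz hzu]
    · omega
    · intro w hw
      rwa [ilt_left_of_prefix (hh.below w (hbot w hw)) (hh.not_prefix hz (ilt_ne hzu).symm)]

/-- Ranks in `L` are those in the union. The flag `f` is 0 if `L` keeps the bottom boundary node; if
it is 1, then `L` has none, all of `L` precedes the one of the union, and the first offset serves as
both. -/
theorem left (h : QueryState N G goal (L ∪ R) v bot i j a b g) (hs : Splits L R v)
    (f : ℕ) (hf : f = 0 ∧ bot = botL ∨ f = 1 ∧ botL = none ∧ ∀ w ∈ bot, w ∈ R ∧ w ≠ v)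
    (hj : j < rk L v) :
    QueryState N G goal L v botL i j a (if f = 0 then b else a) g := by
  have hcard := card_union_add_one hs.inter
  have hRpos := Finset.card_pos.2 ⟨v, hs.right_mem⟩
  have ha := h.before_le
  have hb := h.after_le
  refine ⟨?_, ?_, ?_, h.top, by omega, by split_ifs <;> omega⟩
  · obtain ⟨x, hx, y, hy, hxy, rfl, rfl, hgoal⟩ := h.query
    have hlt := rk_lt hx hxy
    have mem : ∀ z ∈ L ∪ R, rk (L ∪ R) z < rk L v → z ∈ L := by
      intro z hz hzv
      by_contra hzL
      have := hs.rk_right ((Finset.mem_union.1 hz).resolve_left hzL)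
      omega
    have hxL := mem x hx (by omega)
    have hyL := mem y hy hj
    exact ⟨x, hxL, y, hyL, hxy, (hs.rk_left hxL).symm, (hs.rk_left hyL).symm, hgoal⟩
  · intro z hz hzu
    rw [← hs.rk_left hz]
    refine h.before z (Finset.mem_union_left _ hz) ?_
    rcases hf with ⟨_, rfl⟩ | ⟨_, _, hf⟩
    · exact hzu
    · exact fun w hw => hs.lt_of_left_of_right hz (hf w hw).1 (.inr (hf w hw).2)
  · intro z hz hzu
    rw [← hs.rk_left hz]
    rcases hf with ⟨rfl, rfl⟩ | ⟨rfl, _, hf⟩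
    · exact h.after z (Finset.mem_union_left _ hz) hzu
    · exact h.before z (Finset.mem_union_left _ hz) fun w hw =>
        hs.lt_of_left_of_right hz (hf w hw).1 (.inr (hf w hw).2)

/-- Mirror image of `left`: if `R` has no bottom boundary node, all of `R` comes after the one of
the union and the second offset serves as both. Ranks in `R` also drop by `rk L v`. -/
theorem right (h : QueryState N G goal (L ∪ R) v bot i j a b g) (hs : Splits L R v)
    (hR : IsPiece R v botR) (f : ℕ)
    (hf : f = 0 ∧ bot = botR ∨ f = 1 ∧ botR = none ∧ ∀ w ∈ bot, w ∈ L ∧ w ≠ v)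
    (hi : rk L v < i) (a' : ℕ) (ha' : a' = if f = 0 then a else b)
    (e : ℕ) (he : ∀ w ∈ botR, e = 0 ↔ rk R v < rk R w) :
    QueryState N G goal R v botR (i - rk L v) (j - rk L v) (a' + rk L v) (b + rk L v)
      (rk R v + if e = 0 then a' + rk L v else b + rk L v) := by
  have hcard := card_union_add_one hs.inter
  have hv := rk_lt_card hs.left_mem
  have ha := h.before_le
  have hb := h.after_le
  have key : QueryState N G goal R v botR (i - rk L v) (j - rk L v) (a' + rk L v) (b + rk L v)
      (G v) := by
    refine ⟨?_, ?_, ?_, rfl, by rw [ha']; split_ifs <;> omega, by omega⟩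
    · obtain ⟨x, hx, y, hy, hxy, rfl, rfl, hgoal⟩ := h.query
      have hlt := rk_lt hx hxy
      have mem : ∀ z ∈ L ∪ R, rk L v < rk (L ∪ R) z → z ∈ R := by
        intro z hz hzv
        by_contra hzR
        have hzL := (Finset.mem_union.1 hz).resolve_right hzR
        have h1 := hs.rk_left hzL
        have h2 := rk_lt_card hzL
        have h3 := hs.rk_left_top
        omega
      have hxR := mem x hx hi
      have hyR := mem y hy (by omega)
      refine ⟨x, hxR, y, hyR, hxy, ?_, ?_, hgoal⟩
      · rw [hs.rk_right hxR]; omega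
      · rw [hs.rk_right hyR]; omega
    · intro z hz hzu
      have h1 := hs.rk_right hz
      rw [ha']
      rcases hf with ⟨rfl, rfl⟩ | ⟨rfl, _, hf⟩
      · rw [h.before z (Finset.mem_union_right _ hz) hzu, if_pos rfl]
        omega
      · rw [h.after z (Finset.mem_union_right _ hz) fun w hw =>
          hs.lt_of_left_of_right (hf w hw).1 hz (.inl (hf w hw).2), if_neg (by simp)]
        omega
    · intro z hz hzu
      have h1 := hs.rk_right hz
      rcases hf with ⟨rfl, rfl⟩ | ⟨rfl, _, hf⟩
      · rw [h.after z (Finset.mem_union_right _ hz) hzu]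
        omega
      · rw [h.after z (Finset.mem_union_right _ hz) fun w hw =>
          hs.lt_of_left_of_right (hf w hw).1 hz (.inl (hf w hw).2)]
        omega
  rw [← key.top_eq hR e he]
  exact key

end QueryState

/-! ### The query program -/

/-- The query program. The registers `0, 1` hold the ranks of the query nodes in the current
cluster, `2` the address of its record, `3, 4` the offsets of the global ranks before and after
the bottom boundary node, `5` the global rank of the top boundary node; the ten fields of the
record are read into the registers from `10` on. -/
def program : List Instr := [
  .jumpEq 0 1 26, .const 6 1, .read 5 2,
  .move 8 2, .read 10 8,
  .add 8 8 6, .read 11 8,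
  .add 8 8 6, .read 12 8,
  .add 8 8 6, .read 13 8,
  .add 8 8 6, .read 14 8,
  .add 8 8 6, .read 15 8,
  .add 8 8 6, .read 16 8,
  .add 8 8 6, .read 17 8,
  .add 8 8 6, .read 18 8,
  .add 8 8 6, .read 19 8,
  .jumpLt 10 0 27, .jumpLt 1 10 27, .move 0 5, .halt,
  .add 20 11 12, .jumpLt 0 11 42, .jumpLt 20 1 42,
  .sub 0 0 11, .sub 1 1 11, .jumpEq 17 7 34, .move 3 4, .add 3 3 11, .add 4 4 11,
  .move 5 3, .jumpEq 18 7 39, .move 5 4, .add 5 5 19, .move 2 15, .jump 3,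
  .jumpLt 0 11 47, .jumpLt 20 0 46, .move 0 11, .jump 47, .sub 0 0 12,
  .jumpLt 1 11 52, .jumpLt 20 1 51, .move 1 11, .jump 52, .sub 1 1 12,
  .jumpEq 16 7 54, .move 4 3, .add 4 4 13, .move 2 14, .jump 3]

/-- Started at `s`, the program halts after at most `k` steps with `x` in register `0`. -/
def Halts (w : ℕ) (D : List ℕ) (s : Config) (k x : ℕ) : Prop :=
  ∃ t ≤ k, ∃ s', steps w program D t s = some s' ∧ program[s'.pc]? = some .halt ∧ s'.reg 0 = x

/-! ### Backward rules, one for each instruction that is used -/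

namespace Halts

variable {w : ℕ} {D : List ℕ} {k x pc : ℕ} {r : ℕ → ℕ} {m : List ℕ}

theorem mono {s : Config} {k' : ℕ} (h : Halts w D s k x) (hk : k ≤ k') : Halts w D s k' x := by
  obtain ⟨t, ht, h⟩ := h
  exact ⟨t, ht.trans hk, h⟩

theorem halt (hp : program[pc]? = some .halt) (hx : r 0 = x) : Halts w D ⟨pc, r, m⟩ k x :=
  ⟨0, Nat.zero_le _, _, rfl, hp, hx⟩

theorem step {s s' : Config} {c : Instr} (hp : program[s.pc]? = some c)
    (he : exec w D s c = some s') (h : Halts w D s' k x) : Halts w D s (k + 1) x := by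
  obtain ⟨t, ht, s'', h1, h2⟩ := h
  refine ⟨t + 1, by omega, s'', ?_, h2⟩
  rw [steps, TopTreeRMQ.step, hp]
  simp [he, h1]

theorem const {d c : ℕ} (hp : program[pc]? = some (.const d c)) (hc : c < 2 ^ w)
    (h : Halts w D ⟨pc + 1, Function.update r d c, m⟩ k x) : Halts w D ⟨pc, r, m⟩ (k + 1) x :=
  h.step hp (by simp [exec, Config.put, Nat.mod_eq_of_lt hc])

theorem move {d c : ℕ} (hp : program[pc]? = some (.move d c)) (v : ℕ) (hv : r c = v)
    (h : Halts w D ⟨pc + 1, Function.update r d v, m⟩ k x) : Halts w D ⟨pc, r, m⟩ (k + 1) x :=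
  h.step hp (by simp [exec, Config.put, hv])

theorem add {d c c' : ℕ} (hp : program[pc]? = some (.add d c c')) (v : ℕ) (hv : r c + r c' = v)
    (hw : v < 2 ^ w)
    (h : Halts w D ⟨pc + 1, Function.update r d v, m⟩ k x) : Halts w D ⟨pc, r, m⟩ (k + 1) x :=
  h.step hp (by simp [exec, Config.put, hv, Nat.mod_eq_of_lt hw])

theorem sub {d c c' : ℕ} (hp : program[pc]? = some (.sub d c c')) (v : ℕ) (hv : r c = v + r c')
    (hw : v < 2 ^ w)
    (h : Halts w D ⟨pc + 1, Function.update r d v, m⟩ k x) : Halts w D ⟨pc, r, m⟩ (k + 1) x := by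
  refine h.step hp ?_
  have : r c + 2 ^ w - r c' = v + 2 ^ w := by omega
  simp [exec, Config.put, this, Nat.mod_eq_of_lt hw]

theorem read {d c : ℕ} (hp : program[pc]? = some (.read d c)) (v : ℕ) (hv : D[r c]? = some v)
    (h : Halts w D ⟨pc + 1, Function.update r d v, m⟩ k x) : Halts w D ⟨pc, r, m⟩ (k + 1) x :=
  h.step hp (by simp [exec, Config.put, hv])

theorem jump {l : ℕ} (hp : program[pc]? = some (.jump l))
    (h : Halts w D ⟨l, r, m⟩ k x) : Halts w D ⟨pc, r, m⟩ (k + 1) x :=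
  h.step hp rfl

theorem jumpEq {c c' l : ℕ} (hp : program[pc]? = some (.jumpEq c c' l)) (hc : r c = r c')
    (h : Halts w D ⟨l, r, m⟩ k x) : Halts w D ⟨pc, r, m⟩ (k + 1) x :=
  h.step hp (by simp [exec, hc])

theorem not_jumpEq {c c' l : ℕ} (hp : program[pc]? = some (.jumpEq c c' l)) (hc : r c ≠ r c')
    (h : Halts w D ⟨pc + 1, r, m⟩ k x) : Halts w D ⟨pc, r, m⟩ (k + 1) x :=
  h.step hp (by simp [exec, hc])

theorem jumpLt {c c' l : ℕ} (hp : program[pc]? = some (.jumpLt c c' l)) (hc : r c < r c')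
    (h : Halts w D ⟨l, r, m⟩ k x) : Halts w D ⟨pc, r, m⟩ (k + 1) x :=
  h.step hp (by simp [exec, hc])

theorem not_jumpLt {c c' l : ℕ} (hp : program[pc]? = some (.jumpLt c c' l)) (hc : ¬ r c < r c')
    (h : Halts w D ⟨pc + 1, r, m⟩ k x) : Halts w D ⟨pc, r, m⟩ (k + 1) x :=
  h.step hp (by simp [exec, hc])

end Halts

/-- The contents of the registers that are kept from one cluster to the next. -/
structure StateRegs (r : ℕ → ℕ) (q i j a b g : ℕ) : Prop where
  r0 : r 0 = i
  r1 : r 1 = j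
  r2 : r 2 = q
  r3 : r 3 = a
  r4 : r 4 = b
  r5 : r 5 = g
  r6 : r 6 = 1
  r7 : r 7 = 0

/-- The registers that hold the fields of the current record. -/
structure RecordRegs (r : ℕ → ℕ) (t p s s' qA qB fA fB fg tB : ℕ) : Prop where
  r10 : r 10 = t
  r11 : r 11 = p
  r12 : r 12 = s
  r13 : r 13 = s'
  r14 : r 14 = qA
  r15 : r 15 = qB
  r16 : r 16 = fA
  r17 : r 17 = fB
  r18 : r 18 = fg
  r19 : r 19 = tB

/-! ### The basic blocks of the program -/

section Blocks

variable {w : ℕ} {D : List ℕ} {k x : ℕ} {r : ℕ → ℕ} {m : List ℕ}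
  {q i j a b g t p s s' qA qB fA fB fg tB : ℕ}

theorem halts_read_record (hr : StateRegs r q i j a b g)
    (hD : ∀ l v, [t, p, s, s', qA, qB, fA, fB, fg, tB][l]? = some v → D[q + l]? = some v)
    (hq : q + 10 ≤ 2 ^ w)
    (h : ∀ r', StateRegs r' q i j a b g → RecordRegs r' t p s s' qA qB fA fB fg tB →
      Halts w D ⟨23, r', m⟩ k x) : Halts w D ⟨3, r, m⟩ (k + 20) x := by
  refine .move rfl q hr.r2 ?_
  refine .read rfl t (by simpa [hr.r6] using hD 0 t rfl) ?_
  refine .add rfl (q + 1) (by simp [hr.r6]) (by omega) ?_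
  refine .read rfl p (by simpa [hr.r6] using hD 1 p rfl) ?_
  refine .add rfl (q + 2) (by simp [hr.r6]) (by omega) ?_
  refine .read rfl s (by simpa [hr.r6] using hD 2 s rfl) ?_
  refine .add rfl (q + 3) (by simp [hr.r6]) (by omega) ?_
  refine .read rfl s' (by simpa [hr.r6] using hD 3 s' rfl) ?_
  refine .add rfl (q + 4) (by simp [hr.r6]) (by omega) ?_
  refine .read rfl qA (by simpa [hr.r6] using hD 4 qA rfl) ?_
  refine .add rfl (q + 5) (by simp [hr.r6]) (by omega) ?_
  refine .read rfl qB (by simpa [hr.r6] using hD 5 qB rfl) ?_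
  refine .add rfl (q + 6) (by simp [hr.r6]) (by omega) ?_
  refine .read rfl fA (by simpa [hr.r6] using hD 6 fA rfl) ?_
  refine .add rfl (q + 7) (by simp [hr.r6]) (by omega) ?_
  refine .read rfl fB (by simpa [hr.r6] using hD 7 fB rfl) ?_
  refine .add rfl (q + 8) (by simp [hr.r6]) (by omega) ?_
  refine .read rfl fg (by simpa [hr.r6] using hD 8 fg rfl) ?_
  refine .add rfl (q + 9) (by simp [hr.r6]) (by omega) ?_
  refine .read rfl tB (by simpa [hr.r6] using hD 9 tB rfl) ?_
  obtain ⟨h0, h1, h2, h3, h4, h5, h6, h7⟩ := hr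
  exact h _ ⟨h0, h1, h2, h3, h4, h5, h6, h7⟩ ⟨rfl, rfl, rfl, rfl, rfl, rfl, rfl, rfl, rfl, rfl⟩

theorem halts_answer (hr : StateRegs r q i j a b g)
    (hf : RecordRegs r t p s s' qA qB fA fB fg tB) (hi : i ≤ t) (hj : t ≤ j) :
    Halts w D ⟨23, r, m⟩ (k + 3) g := by
  refine .not_jumpLt rfl (by rw [hf.r10, hr.r0]; omega) ?_
  refine .not_jumpLt rfl (by rw [hf.r10, hr.r1]; omega) ?_
  refine .move rfl g hr.r5 ?_
  exact .halt rfl rfl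

theorem halts_no_answer (hr : StateRegs r q i j a b g)
    (hf : RecordRegs r t p s s' qA qB fA fB fg tB) (hij : ¬ (i ≤ t ∧ t ≤ j))
    (h : Halts w D ⟨27, r, m⟩ k x) : Halts w D ⟨23, r, m⟩ (k + 2) x := by
  by_cases hi : t < i
  · exact (Halts.jumpLt rfl (by rwa [hf.r10, hr.r0]) h).mono (by omega)
  · refine .not_jumpLt rfl (by rwa [hf.r10, hr.r0]) ?_
    exact .jumpLt rfl (by rw [hf.r10, hr.r1]; omega) h

theorem halts_inner (hr : StateRegs r q i j a b g)
    (hf : RecordRegs r t p s s' qA qB fA fB fg tB) (hi : p ≤ i) (hj : j ≤ p + s) (hij : i ≤ j)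
    (hps : p + s < 2 ^ w) (a' : ℕ) (ha' : a' = if fB = 0 then a else b) (hpa : a' + p < 2 ^ w)
    (hpb : b + p < 2 ^ w) (hg : tB + (if fg = 0 then a' + p else b + p) < 2 ^ w)
    (h : ∀ r', StateRegs r' qB (i - p) (j - p) (a' + p) (b + p)
      (tB + if fg = 0 then a' + p else b + p) → Halts w D ⟨3, r', m⟩ k x) :
    Halts w D ⟨27, r, m⟩ (k + 15) x := by
  obtain ⟨h0, h1, h2, h3, h4, h5, h6, h7⟩ := hr
  obtain ⟨f0, f1, f2, f3, f4, f5, f6, f7, f8, f9⟩ := hf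
  refine .add rfl (p + s) (by rw [f1, f2]) hps ?_
  refine .not_jumpLt rfl (by simp [h0, f1, hi]) ?_
  refine .not_jumpLt rfl (by simp [h1, hj]) ?_
  refine .sub rfl (i - p) (by simp [h0, f1, hi]) (by omega) ?_
  refine .sub rfl (j - p) (by simp [h1, f1, hi.trans hij]) (by omega) ?_
  -- The join point 34 after the choice of the first offset: the inner part is governed by the
  -- second offset alone if `fB` is not 0.
  have offset : ∀ r', StateRegs r' q (i - p) (j - p) a' b g →
      RecordRegs r' t p s s' qA qB fA fB fg tB → Halts w D ⟨34, r', m⟩ (k + 8) x := by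
    rintro r ⟨h0, h1, h2, h3, h4, h5, h6, h7⟩ ⟨f0, f1, f2, f3, f4, f5, f6, f7, f8, f9⟩
    refine .add rfl (a' + p) (by rw [h3, f1]) hpa ?_
    refine .add rfl (b + p) (by simp [h4, f1]) hpb ?_
    refine .move rfl (a' + p) (by simp) ?_
    by_cases hfg : fg = 0
    · rw [if_pos hfg] at h hg
      refine Halts.mono (k := k + 4) (.jumpEq rfl (by simp [f8, h7, hfg])
        ?_) (by omega)
      refine .add rfl (tB + (a' + p)) (by simp [f9, add_comm]) hg ?_
      refine .move rfl qB (by simp [f5]) ?_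
      exact .jump rfl (h _ ⟨h0, h1, rfl, rfl, rfl, rfl, h6, h7⟩)
    · rw [if_neg hfg] at h hg
      refine .not_jumpEq rfl (by simp [f8, h7, hfg]) ?_
      refine .move rfl (b + p) (by simp) ?_
      refine .add rfl (tB + (b + p)) (by simp [f9, add_comm]) hg ?_
      refine .move rfl qB (by simp [f5]) ?_
      exact .jump rfl (h _ ⟨h0, h1, rfl, rfl, rfl, rfl, h6, h7⟩)
  by_cases hfB : fB = 0
  · rw [if_pos hfB] at ha'
    subst ha'
    refine Halts.mono (k := k + 9) (.jumpEq rfl (by simp [f7, h7, hfB])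
      ?_) (by omega)
    exact offset _ ⟨rfl, rfl, h2, h3, h4, h5, h6, h7⟩ ⟨f0, f1, f2, f3, f4, f5, f6, f7, f8, f9⟩
  · rw [if_neg hfB] at ha'
    subst ha'
    refine .not_jumpEq rfl (by simp [f7, h7, hfB]) ?_
    refine .move rfl a' (by simp [h4]) ?_
    exact offset _ ⟨rfl, rfl, h2, rfl, h4, h5, h6, h7⟩ ⟨f0, f1, f2, f3, f4, f5, f6, f7, f8, f9⟩

open QueryState in
theorem halts_outer (hr : StateRegs r q i j a b g)
    (hf : RecordRegs r t p s s' qA qB fA fB fg tB) (hij : ¬ (p ≤ i ∧ j ≤ p + s))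
    (hps : p + s < 2 ^ w) (hi : i < 2 ^ w) (hj : j < 2 ^ w) (b' : ℕ)
    (hb' : b' = if fA = 0 then b else a) (hb : b' + s' < 2 ^ w)
    (h : ∀ r', StateRegs r' qA (collapse p s i) (collapse p s j) a (b' + s') g →
      Halts w D ⟨3, r', m⟩ k x) :
    Halts w D ⟨27, r, m⟩ (k + 16) x := by
  obtain ⟨h0, h1, h2, h3, h4, h5, h6, h7⟩ := hr
  obtain ⟨f0, f1, f2, f3, f4, f5, f6, f7, f8, f9⟩ := hf
  -- The continuations at the join points 52, 47 and 42 are treated in reverse order of execution,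
  -- as each of them is reached along several branches.
  have offset : ∀ r', StateRegs r' q (collapse p s i) (collapse p s j) a b g →
      RecordRegs r' t p s s' qA qB fA fB fg tB → Halts w D ⟨52, r', m⟩ (k + 5) x := by
    rintro r ⟨h0, h1, h2, h3, h4, h5, h6, h7⟩ ⟨f0, f1, f2, f3, f4, f5, f6, f7, f8, f9⟩
    by_cases hfA : fA = 0
    · rw [if_pos hfA] at hb'
      subst hb'
      refine Halts.mono (k := k + 4) (.jumpEq rfl (by rw [f6, h7, hfA]) ?_) (by omega)
      refine .add rfl (b' + s') (by rw [h4, f3]) hb ?_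
      refine .move rfl qA (by simp [f4]) ?_
      exact .jump rfl (h _ ⟨h0, h1, rfl, h3, rfl, h5, h6, h7⟩)
    · rw [if_neg hfA] at hb'
      subst hb'
      refine .not_jumpEq rfl (by rwa [f6, h7]) ?_
      refine .move rfl b' h3 ?_
      refine .add rfl (b' + s') (by simp [f3]) hb ?_
      refine .move rfl qA (by simp [f4]) ?_
      exact .jump rfl (h _ ⟨h0, h1, rfl, h3, rfl, h5, h6, h7⟩)
  have second : ∀ r', StateRegs r' q (collapse p s i) j a b g →
      RecordRegs r' t p s s' qA qB fA fB fg tB → r' 20 = p + s →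
      Halts w D ⟨47, r', m⟩ (k + 9) x := by
    rintro r ⟨h0, h1, h2, h3, h4, h5, h6, h7⟩ ⟨f0, f1, f2, f3, f4, f5, f6, f7, f8, f9⟩ h20
    by_cases hjp : j < p
    · refine Halts.mono (k := k + 6) (.jumpLt rfl (by rwa [h1, f1]) ?_) (by omega)
      refine offset _ ⟨h0, ?_, h2, h3, h4, h5, h6, h7⟩ ⟨f0, f1, f2, f3, f4, f5, f6, f7, f8, f9⟩
      rw [h1, collapse, if_pos hjp]
    · refine .not_jumpLt rfl (by rwa [h1, f1]) ?_
      by_cases hjs : j ≤ p + s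
      · refine .not_jumpLt rfl (by rw [h1, h20]; omega) ?_
        refine .move rfl p f1 ?_
        refine .jump rfl ?_
        refine offset _ ⟨h0, ?_, h2, h3, h4, h5, h6, h7⟩
          ⟨f0, f1, f2, f3, f4, f5, f6, f7, f8, f9⟩
        rw [collapse, if_neg hjp, if_pos hjs]
        rfl
      · refine Halts.mono (k := k + 7) (.jumpLt rfl (by rw [h1, h20]; omega) ?_) (by omega)
        refine .sub rfl (j - s) (by rw [h1, f2]; omega) (by omega) ?_
        refine offset _ ⟨h0, ?_, h2, h3, h4, h5, h6, h7⟩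
          ⟨f0, f1, f2, f3, f4, f5, f6, f7, f8, f9⟩
        rw [collapse, if_neg hjp, if_neg hjs]
        rfl
  have first : ∀ r', StateRegs r' q i j a b g →
      RecordRegs r' t p s s' qA qB fA fB fg tB → r' 20 = p + s →
      Halts w D ⟨42, r', m⟩ (k + 13) x := by
    rintro r ⟨h0, h1, h2, h3, h4, h5, h6, h7⟩ ⟨f0, f1, f2, f3, f4, f5, f6, f7, f8, f9⟩ h20
    by_cases hip : i < p
    · refine Halts.mono (k := k + 10) (.jumpLt rfl (by rwa [h0, f1]) ?_) (by omega)
      refine second _ ⟨?_, h1, h2, h3, h4, h5, h6, h7⟩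
        ⟨f0, f1, f2, f3, f4, f5, f6, f7, f8, f9⟩ h20
      rw [h0, collapse, if_pos hip]
    · refine .not_jumpLt rfl (by rwa [h0, f1]) ?_
      by_cases his : i ≤ p + s
      · refine .not_jumpLt rfl (by rw [h0, h20]; omega) ?_
        refine .move rfl p f1 ?_
        refine .jump rfl ?_
        refine second _ ⟨?_, h1, h2, h3, h4, h5, h6, h7⟩
          ⟨f0, f1, f2, f3, f4, f5, f6, f7, f8, f9⟩ h20
        rw [collapse, if_neg hip, if_pos his]
        rfl
      · refine Halts.mono (k := k + 11) (.jumpLt rfl (by rw [h0, h20]; omega) ?_) (by omega)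
        refine .sub rfl (i - s) (by rw [h0, f2]; omega) (by omega) ?_
        refine second _ ⟨?_, h1, h2, h3, h4, h5, h6, h7⟩
          ⟨f0, f1, f2, f3, f4, f5, f6, f7, f8, f9⟩ h20
        rw [collapse, if_neg hip, if_neg his]
        rfl
  refine .add rfl (p + s) (by rw [f1, f2]) hps ?_
  by_cases hip : i < p
  · refine Halts.mono (k := k + 14) (.jumpLt rfl (by simpa [h0, f1]) ?_)
      (by omega)
    exact first _ ⟨h0, h1, h2, h3, h4, h5, h6, h7⟩ ⟨f0, f1, f2, f3, f4, f5, f6, f7, f8, f9⟩ rfl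
  · refine .not_jumpLt rfl (by simp [h0, f1]; omega) ?_
    refine .jumpLt rfl (by simp [h1]; omega) ?_
    exact first _ ⟨h0, h1, h2, h3, h4, h5, h6, h7⟩ ⟨f0, f1, f2, f3, f4, f5, f6, f7, f8, f9⟩ rfl

end Blocks

/-! ### The data structure -/

/-- The record of a merge with outer part `a` and inner part `b`. -/
def mergeRecord (addr : TopTree → ℕ) (t p s s' : ℕ) (a b : TopTree) (fA fB : ℕ) : List ℕ :=
  [t, p, s, s', addr a, addr b, fA, fB, if topRank b < bottomRank b then 0 else 1, topRank b]

/-- The record of a horizontal merge with left part `l` and right part `r`; the flags `fL`, `fR`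
are `0` if the bottom boundary node belongs to that part. -/
def horizontalRecord (addr : TopTree → ℕ) (l r : TopTree) (fL fR : ℕ) : List ℕ :=
  mergeRecord addr (topRank l) (topRank l) (size r - 1) 0 l r fL fR

/-- The record of a node of the DAG, in which `addr` gives the addresses of the records. In a
horizontal merge the part with top boundary node of rank `0` is the right one. -/
def record (addr : TopTree → ℕ) : TopTree → List ℕ
  | .edge b => [topRank (.edge b), 0, 0, 0, 0, 0, 0, 0, 0, 0]
  | .merge .vertical a b =>
      mergeRecord addr (topRank (.merge .vertical a b)) (bottomRank a) (size b - 1) (size b - 1)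
        a b 0 0
  | .merge .horizontalLeft a b =>
      if topRank a = 0 then horizontalRecord addr b a 1 0 else horizontalRecord addr a b 0 1
  | .merge .horizontalRight a b =>
      if topRank a = 0 then horizontalRecord addr b a 0 1 else horizontalRecord addr a b 1 0
  | .merge .horizontalNone a b =>
      if topRank a = 0 then horizontalRecord addr b a 1 1 else horizontalRecord addr a b 1 1

theorem length_record (addr : TopTree → ℕ) (τ : TopTree) : (record addr τ).length = 10 := by
  rcases τ with b | ⟨_ | _ | _ | _, a, b⟩ <;> simp only [record] <;> (try split_ifs) <;> rfl

theorem lt_of_mem_mergeRecord {addr : TopTree → ℕ} {t p s s' fA fB M x : ℕ} {a b : TopTree}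
    (hx : x ∈ mergeRecord addr t p s s' a b fA fB) (ht : t < M) (hp : p < M) (hs : s < M)
    (hs' : s' < M) (haddr : ∀ σ, addr σ < M) (hfA : fA < 2) (hfB : fB < 2) (hb : size b ≤ M) :
    x < M := by
  have h2 := two_le_size b
  have h3 := boundaryRanks_lt_size b
  simp only [mergeRecord, List.mem_cons, List.not_mem_nil, or_false] at hx
  rcases hx with rfl | rfl | rfl | rfl | rfl | rfl | rfl | rfl | rfl | rfl
  any_goals first | omega | exact haddr _
  split_ifs <;> omega

theorem lt_of_mem_record {addr : TopTree → ℕ} {M x : ℕ} {τ : TopTree} (hx : x ∈ record addr τ)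
    (haddr : ∀ σ, addr σ < M) (hM : size τ ≤ M) : x < M := by
  have h0 := boundaryRanks_lt_size τ
  have h2 := two_le_size τ
  rcases τ with e | ⟨m, a, b⟩
  · simp only [record, List.mem_cons, List.not_mem_nil, or_false] at hx
    omega
  · have ha := boundaryRanks_lt_size a
    have hb := boundaryRanks_lt_size b
    have ha2 := two_le_size a
    have hb2 := two_le_size b
    have hsize : size (.merge m a b) = size a + size b - 1 := rfl
    rcases m with _ | _ | _ | _ <;> simp only [record, horizontalRecord] at hx <;>
      (try split_ifs at hx) <;>
      exact lt_of_mem_mergeRecord hx (by omega) (by omega) (by omega) (by omega) haddr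
        (by omega) (by omega) (by omega)

/-- A binary tree with `e` leaves has `2 * e - 1` nodes, and a cluster with `e` edges has `e + 1`
nodes. So addresses are linear in the length of the string and fit into words. -/
theorem dagSize_add_three_le (τ : TopTree) : dagSize τ + 3 ≤ 2 * size τ := by
  induction τ with
  | edge b => simp [dagSize, dagNodes, size]
  | merge m a b iha ihb =>
    have h1 := two_le_size a
    have h2 := two_le_size b
    have h3 := Finset.card_insert_le (.merge m a b) (dagNodes a ∪ dagNodes b)
    have h4 := Finset.card_union_le (dagNodes a) (dagNodes b)
    simp only [dagSize, dagNodes, size] at *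
    omega

theorem self_mem_dagNodes (τ : TopTree) : τ ∈ dagNodes τ := by
  cases τ <;> simp [dagNodes]

theorem size_le_of_mem_dagNodes {σ τ : TopTree} (h : σ ∈ dagNodes τ) : size σ ≤ size τ := by
  induction τ with
  | edge b =>
    rw [dagNodes, Finset.mem_singleton] at h
    rw [h]
  | merge m a b iha ihb =>
    have h1 := two_le_size a
    have h2 := two_le_size b
    simp only [dagNodes, Finset.mem_insert, Finset.mem_union] at h
    rcases h with rfl | h | h
    · rfl
    · have := iha h
      simp only [size]; omega
    · have := ihb h
      simp only [size]; omega

/-- The nodes of the DAG, the source first. -/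
noncomputable def dagList (τ : TopTree) : List TopTree := τ :: ((dagNodes τ).erase τ).toList

theorem length_dagList (τ : TopTree) : (dagList τ).length = dagSize τ := by
  have := Finset.card_pos.2 ⟨τ, self_mem_dagNodes τ⟩
  rw [dagList, List.length_cons, Finset.length_toList,
    Finset.card_erase_of_mem (self_mem_dagNodes τ), dagSize]
  omega

theorem mem_dagList {σ τ : TopTree} : σ ∈ dagList τ ↔ σ ∈ dagNodes τ := by
  by_cases h : σ = τ
  · simp [h, dagList, self_mem_dagNodes]
  · simp [dagList, h]

/-- The address of the record of `σ` in the data structure for `τ`. -/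
noncomputable def address (τ σ : TopTree) : ℕ := 10 * (dagList τ).idxOf σ

/-- Register 2 is initially 0, so it already holds the address of the source. -/
theorem address_self (τ : TopTree) : address τ τ = 0 := by
  simp [address, dagList]

/-- True also outside the DAG, where `idxOf` returns the length of the list; hence no membership is
needed when bounding the words of a record. -/
theorem address_le (τ σ : TopTree) : address τ σ ≤ 10 * dagSize τ := by
  have := List.idxOf_le_length (a := σ) (l := dagList τ)
  rw [length_dagList] at this
  rw [address]
  omega

theorem address_add_ten_le {τ σ : TopTree} (h : σ ∈ dagNodes τ) :
    address τ σ + 10 ≤ 10 * dagSize τ := by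
  have := List.idxOf_lt_length_iff.2 (mem_dagList.2 h)
  rw [length_dagList] at this
  rw [address]
  omega

/-- The data structure: the records of the nodes of the DAG. -/
noncomputable def dataStructure (τ : TopTree) : List ℕ :=
  (List.range (10 * dagSize τ)).map fun q =>
    (record (address τ) ((dagList τ).getD (q / 10) τ)).getD (q % 10) 0

theorem length_dataStructure (τ : TopTree) : (dataStructure τ).length = 10 * dagSize τ := by
  simp [dataStructure]

theorem dataStructure_getElem {τ σ : TopTree} (h : σ ∈ dagNodes τ) {l v : ℕ}
    (hv : (record (address τ) σ)[l]? = some v) :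
    (dataStructure τ)[address τ σ + l]? = some v := by
  have hl : l < 10 := by
    have := (List.getElem?_eq_some_iff.1 hv).1
    rwa [length_record] at this
  have hlen := address_add_ten_le h
  have hidx := List.idxOf_lt_length_iff.2 (mem_dagList.2 h)
  rw [dataStructure, List.getElem?_map, List.getElem?_range (by omega), Option.map_some]
  have h1 : (address τ σ + l) / 10 = (dagList τ).idxOf σ := by rw [address]; omega
  have h2 : (address τ σ + l) % 10 = l := by rw [address]; omega
  rw [h1, h2, List.getD_eq_getElem _ _ hidx, List.getElem_idxOf hidx,
    List.getD_eq_getElem?_getD, hv, Option.getD_some]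

theorem lt_of_mem_dataStructure {τ : TopTree} {x M : ℕ} (hx : x ∈ dataStructure τ)
    (hM : 10 * dagSize τ < M) (hM' : size τ ≤ M) : x < M := by
  rw [dataStructure, List.mem_map] at hx
  obtain ⟨q, hq, rfl⟩ := hx
  rw [List.mem_range] at hq
  have hidx : q / 10 < (dagList τ).length := by rw [length_dagList]; omega
  have hfield : q % 10 < (record (address τ) ((dagList τ).getD (q / 10) τ)).length := by
    rw [length_record]; omega
  rw [List.getD_eq_getElem _ _ hfield]
  refine lt_of_mem_record (List.getElem_mem _) (fun σ => (address_le τ σ).trans_lt hM) ?_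
  rw [List.getD_eq_getElem _ _ hidx]
  exact (size_le_of_mem_dagNodes (mem_dagList.1 (List.getElem_mem _))).trans hM'

/-! ### Correctness of the program -/

section Correctness

variable {w N : ℕ} {D : List ℕ} {G : Node → ℕ} {goal : Node} {addr : TopTree → ℕ}

/-- From each state at a cluster of shape `σ`, the program finds the global rank of the goal
within `k` steps. -/
def Solves (w : ℕ) (D : List ℕ) (N : ℕ) (G : Node → ℕ) (goal : Node) (addr : TopTree → ℕ)
    (σ : TopTree) (F : Finset Node) (v : Node) (bot : Option Node) (k : ℕ) : Prop :=
  ∀ i j a b g, QueryState N G goal F v bot i j a b g → ∀ r m,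
    StateRegs r (addr σ) i j a b g → Halts w D ⟨3, r, m⟩ k (G goal)

theorem Solves.mono {σ : TopTree} {F : Finset Node} {v : Node} {bot : Option Node} {k k' : ℕ}
    (h : Solves w D N G goal addr σ F v bot k) (hk : k ≤ k') :
    Solves w D N G goal addr σ F v bot k' :=
  fun i j a b g hq r m hr => (h i j a b g hq r m hr).mono hk

theorem Shape.flag_iff {τ : TopTree} {F : Finset Node} {v : Node} {bot : Option Node}
    (h : Shape τ F v bot) :
    ∀ u ∈ bot, (if rk F v < bottomRank τ then 0 else 1) = 0 ↔ rk F v < rk F u := by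
  intro u hu
  rw [h.ranks.2.2 u hu]
  simp

theorem solves_edge {e : Bool} {F : Finset Node} {v : Node} {bot : Option Node}
    (hF : Shape (.edge e) F v bot)
    (hD : ∀ l x, (record addr (.edge e))[l]? = some x → D[addr (.edge e) + l]? = some x)
    (hq : addr (.edge e) + 10 ≤ 2 ^ w) : Solves w D N G goal addr (.edge e) F v bot 38 := by
  intro i j a b g hst r m hr
  refine Halts.mono (k := 23) (halts_read_record (k := 3) hr hD hq fun r' hr' hf => ?_)
    (by omega)
  have hcard : F.card = 2 := hF.ranks.1
  have ht := hF.ranks.2.1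
  have ht' := rk_lt_card hF.isPiece.top_mem
  obtain ⟨hij, hj⟩ := hst.lt
  -- There are only two nodes, so `i = 0` and `j = 1`.
  have hi : i ≤ topRank (.edge e) := by omega
  have hj : topRank (.edge e) ≤ j := by omega
  rw [hst.answer hF.isPiece (by omega) (by omega)]
  exact halts_answer (k := 0) hr' hf hi hj

theorem solves_vertical (hN : N < 2 ^ w) {a b : TopTree} {A B : Finset Node} {v u : Node}
    {bot : Option Node} {k : ℕ} (hA : Shape a A v (some u)) (hB : Shape b B u bot)
    (h : A ∩ B = {u})
    (hD : ∀ l x, (record addr (.merge .vertical a b))[l]? = some x →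
      D[addr (.merge .vertical a b) + l]? = some x)
    (hq : addr (.merge .vertical a b) + 10 ≤ 2 ^ w)
    (solvesA : Solves w D N G goal addr a A v (some u) k)
    (solvesB : Solves w D N G goal addr b B u bot k) :
    Solves w D N G goal addr (.merge .vertical a b) (A ∪ B) v bot (k + 38) := by
  intro i j x y g hst r m hr
  have hC := hA.vertical hB h
  have hh := hA.isPiece.hangs hB.isPiece h
  have hcard := card_union_add_one h
  have hu := rk_lt_card hh.left_mem
  have huB := rk_lt_card hh.right_mem
  have hx := hst.before_le
  have hy := hst.after_le
  obtain ⟨hij, hj⟩ := hst.lt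
  have hp := hA.ranks.2.2 u rfl
  have hs := hB.ranks.1
  have htB := hB.ranks.2.1
  have ht := hC.ranks.2.1
  -- 20 steps to read the record, 2 to rule out the top as the answer, and at most 16 to prepare the
  -- descent.
  refine Halts.mono (k := k + 18 + 20) (halts_read_record hr hD hq fun r' hr' hf => ?_)
    (by omega)
  by_cases ht' : i ≤ topRank (.merge .vertical a b) ∧ topRank (.merge .vertical a b) ≤ j
  · rw [hst.answer hC.isPiece (by omega) (by omega)]
    exact halts_answer (k := k + 15) hr' hf ht'.1 ht'.2
  refine halts_no_answer (k := k + 16) hr' hf ht' ?_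
  rw [← hp, ← hs, ← htB] at hf
  by_cases hB' : rk A u ≤ i ∧ j ≤ rk A u + (B.card - 1)
  · refine Halts.mono (k := k + 15) (halts_inner hr' hf hB'.1 hB'.2 hij.le (by omega) x
      (by simp) (by omega) (by omega) (by split_ifs <;> omega) fun r'' hr'' => ?_) (by omega)
    exact solvesB _ _ _ _ _ (hst.inner hh hB.isPiece hB'.1 hB'.2 _ hB.flag_iff) _ _ hr''
  · refine halts_outer hr' hf hB' (by omega) (by omega) (by omega) y (by simp) (by omega)
      fun r'' hr'' => ?_
    exact solvesA _ _ _ _ _ (hst.outer hh hB.isPiece.bottom_mem hB') _ _ hr''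

/-- A horizontal merge runs through the code for vertical merges, with `L` as the outer and `R` as
the inner part: the ranks of `R` in the union again form an interval, starting at the rank of `v`.
The shift `s'` is 0, since `R` does not hang at the bottom boundary node of `L`; the flags handle
the part that has no bottom boundary node. -/
theorem solves_horizontal (hN : N < 2 ^ w) {σ l r : TopTree} {L R : Finset Node} {v : Node}
    {bot botL botR : Option Node} {k fL fR : ℕ} (hL : Shape l L v botL) (hR : Shape r R v botR)
    (hLR : IsPiece (L ∪ R) v bot) (h : Splits L R v)
    (hfL : fL = 0 ∧ bot = botL ∨ fL = 1 ∧ botL = none ∧ ∀ w ∈ bot, w ∈ R ∧ w ≠ v)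
    (hfR : fR = 0 ∧ bot = botR ∨ fR = 1 ∧ botR = none ∧ ∀ w ∈ bot, w ∈ L ∧ w ≠ v)
    (hrec : record addr σ = horizontalRecord addr l r fL fR)
    (hD : ∀ l x, (record addr σ)[l]? = some x → D[addr σ + l]? = some x)
    (hq : addr σ + 10 ≤ 2 ^ w)
    (solvesL : Solves w D N G goal addr l L v botL k)
    (solvesR : Solves w D N G goal addr r R v botR k) :
    Solves w D N G goal addr σ (L ∪ R) v bot (k + 38) := by
  intro i j x y g hst reg m hr
  have hcard := card_union_add_one h.inter
  have hvL := rk_lt_card h.left_mem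
  have hvR := rk_lt_card h.right_mem
  have hx := hst.before_le
  have hy := hst.after_le
  obtain ⟨hij, hj⟩ := hst.lt
  have hs := hR.ranks.1
  have htR := hR.ranks.2.1
  have htL := hL.ranks.2.1
  have ht := h.rk_left h.left_mem
  have htop := h.rk_left_top
  rw [hrec] at hD
  refine Halts.mono (k := k + 18 + 20) (halts_read_record hr hD hq fun reg' hr' hf => ?_)
    (by omega)
  rw [← hs, ← htR, ← htL] at hf
  by_cases ht' : i ≤ rk L v ∧ rk L v ≤ j
  · rw [hst.answer hLR (by omega) (by omega)]
    exact halts_answer (k := k + 15) hr' hf ht'.1 ht'.2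
  refine halts_no_answer (k := k + 16) hr' hf ht' ?_
  by_cases hi : rk L v < i
  · have hxy : (if fR = 0 then x else y) + (L ∪ R).card ≤ N := by split_ifs <;> omega
    refine Halts.mono (k := k + 15) (halts_inner hr' hf hi.le (by omega) hij.le (by omega) _
      rfl (by omega) (by omega) (by split_ifs at hxy ⊢ <;> omega) fun reg'' hr'' => ?_) (by omega)
    exact solvesR _ _ _ _ _ (hst.right h hR.isPiece fR hfR hi _ rfl _ hR.flag_iff) _ _ hr''
  · have hxy : (if fL = 0 then y else x) + (L ∪ R).card ≤ N := by split_ifs <;> omega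
    refine halts_outer hr' hf (by omega) (by omega) (by omega) (by omega) _ rfl (by omega)
      fun reg'' hr'' => ?_
    -- Both ranks are below that of the top, so collapsing does not change them.
    rw [QueryState.collapse, if_pos (by omega), QueryState.collapse, if_pos (by omega),
      Nat.add_zero] at hr''
    exact solvesL _ _ _ _ _ (hst.left h fL hfL (by omega)) _ _ hr''

theorem Shape.solves (hN : N < 2 ^ w) {σ : TopTree} {F : Finset Node} {v : Node}
    {bot : Option Node} (hF : Shape σ F v bot)
    (hD : ∀ ρ ∈ dagNodes σ, (∀ l x, (record addr ρ)[l]? = some x → D[addr ρ + l]? = some x) ∧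
      addr ρ + 10 ≤ 2 ^ w) :
    Solves w D N G goal addr σ F v bot (38 * (dagDepth σ + 1)) := by
  induction hF with
  | edge v e bot h =>
    obtain ⟨h1, h2⟩ := hD _ (self_mem_dagNodes _)
    exact solves_edge (.edge v e bot h) h1 h2
  | @vertical a b A B v u bot hA hB h ihA ihB =>
    obtain ⟨h1, h2⟩ := hD _ (self_mem_dagNodes _)
    have ihA := ihA fun ρ hρ => hD ρ (by simp [dagNodes, hρ])
    have ihB := ihB fun ρ hρ => hD ρ (by simp [dagNodes, hρ])
    refine (solves_vertical (k := 38 * (max (dagDepth a) (dagDepth b) + 1)) hN hA hB h h1 h2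
      (ihA.mono (by gcongr; exact le_max_left _ _))
      (ihB.mono (by gcongr; exact le_max_right _ _))).mono ?_
    simp only [dagDepth]
    omega
  | @horizontal a b A B v botA botB bot m hA hB h hm ihA ihB =>
    obtain ⟨h1, h2⟩ := hD _ (self_mem_dagNodes _)
    have ihA := (ihA fun ρ hρ => hD ρ (by simp [dagNodes, hρ])).mono
      (k' := 38 * (max (dagDepth a) (dagDepth b) + 1)) (by gcongr; exact le_max_left _ _)
    have ihB := (ihB fun ρ hρ => hD ρ (by simp [dagNodes, hρ])).mono
      (k' := 38 * (max (dagDepth a) (dagDepth b) + 1)) (by gcongr; exact le_max_right _ _)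
    have hC := (Shape.horizontal m hA hB h hm).isPiece
    have pA : ∀ w ∈ botA, w ∈ A ∧ w ≠ v := fun w hw =>
      ⟨hA.isPiece.bottom_mem w hw, hA.isPiece.bottom_ne w hw⟩
    have pB : ∀ w ∈ botB, w ∈ B ∧ w ≠ v := fun w hw =>
      ⟨hB.isPiece.bottom_mem w hw, hB.isPiece.bottom_ne w hw⟩
    have htA := hA.ranks.2.1
    have hdepth : 38 * (max (dagDepth a) (dagDepth b) + 1) + 38
        ≤ 38 * (dagDepth (.merge m a b) + 1) := by
      simp only [dagDepth]
      omega
    refine Solves.mono ?_ hdepth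
    rcases hA.isPiece.splits hB.isPiece h with hs | hs
    -- A left part contains a node before the top, so its top rank is positive; this is how `record`
    -- recognizes which part is on the left.
    · have h0 : topRank a ≠ 0 := by
        obtain ⟨x, hx, hne⟩ := hA.isPiece.nontrivial
        have := rk_lt hx ((hs.left x hx).resolve_left hne)
        omega
      cases m
      · exact hm.elim
      · obtain ⟨rfl, rfl⟩ := hm
        exact solves_horizontal hN hA hB hC hs (.inl ⟨rfl, rfl⟩) (.inr ⟨rfl, rfl, pA⟩)
          (by rw [record, if_neg h0]) h1 h2 ihA ihB
      · obtain ⟨rfl, rfl⟩ := hm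
        exact solves_horizontal hN hA hB hC hs (.inr ⟨rfl, rfl, pB⟩) (.inl ⟨rfl, rfl⟩)
          (by rw [record, if_neg h0]) h1 h2 ihA ihB
      · obtain ⟨rfl, rfl, rfl⟩ := hm
        exact solves_horizontal hN hA hB hC hs (.inr ⟨rfl, rfl, pB⟩) (.inr ⟨rfl, rfl, pA⟩)
          (by rw [record, if_neg h0]) h1 h2 ihA ihB
    · have h0 : topRank a = 0 := by
        rw [← htA, hs.rk_right_top]
      rw [Finset.union_comm] at hC ⊢
      cases m
      · exact hm.elim
      · obtain ⟨rfl, rfl⟩ := hm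
        exact solves_horizontal hN hB hA hC hs (.inr ⟨rfl, rfl, pA⟩) (.inl ⟨rfl, rfl⟩)
          (by rw [record, if_pos h0]) h1 h2 ihB ihA
      · obtain ⟨rfl, rfl⟩ := hm
        exact solves_horizontal hN hB hA hC hs (.inl ⟨rfl, rfl⟩) (.inr ⟨rfl, rfl, pB⟩)
          (by rw [record, if_pos h0]) h1 h2 ihB ihA
      · obtain ⟨rfl, rfl, rfl⟩ := hm
        exact solves_horizontal hN hB hA hC hs (.inr ⟨rfl, rfl, pA⟩) (.inr ⟨rfl, rfl, pB⟩)
          (by rw [record, if_pos h0]) h1 h2 ihB ihA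

end Correctness

/-- For a horizontal merge the stored value is the top rank of the left part alone; it agrees with
that of the union because the top has rank 0 in the right part. -/
theorem record_zero {τ : TopTree} {F : Finset Node} {v : Node} {bot : Option Node}
    (addr : TopTree → ℕ) (h : Shape τ F v bot) : (record addr τ)[0]? = some (topRank τ) := by
  cases h with
  | edge => rfl
  | vertical => rfl
  | @horizontal a b A B _ botA botB _ m hA hB h hm =>
    have key : (topRank a = 0 → topRank (.merge m a b) = topRank b) ∧
        (topRank a ≠ 0 → topRank (.merge m a b) = topRank a) := by
      have ht : topRank (.merge m a b) = topRank a + topRank b := by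
        cases m
        · exact hm.elim
        all_goals rfl
      refine ⟨fun h0 => by omega, fun h0 => ?_⟩
      have htB := hB.ranks.2.1
      have htA := hA.ranks.2.1
      rcases hA.isPiece.splits hB.isPiece h with hs | hs
      · have := hs.rk_right_top
        omega
      · have := hs.rk_right_top
        omega
    by_cases h0 : topRank a = 0
    · rw [key.1 h0]
      cases m
      · exact hm.elim
      all_goals rw [record, if_pos h0]; rfl
    · rw [key.2 h0]
      cases m
      · exact hm.elim
      all_goals rw [record, if_neg h0]; rfl

end TopTreeRMQ

open TopTreeRMQ
/-- There are a query program `P` and a constant `c` such that for every string `S` and every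
top-tree `τ` of its Cartesian tree there is a data structure `D` of at most `c * dagSize τ` words
with which `P` answers all range minimum queries on `S` (the answer being also the inorder number of
the lowest common ancestor in the Cartesian tree) in at most `c * (dagDepth τ + 1)` steps, for all
word sizes `w` with `2 ^ w ≥ c * |S|`, and with `c * dagSize τ` words of scratch space, the initial
contents of which are arbitrary. -/
theorem theorem2 :
    ∃ (P : List Instr) (c : ℕ), ∀ (S : List ℕ) (τ : TopTree), IsTopTree (cartesianTree S) τ →
      ∃ D : List ℕ, D.length ≤ c * dagSize τ ∧
        ∀ w : ℕ, c * S.length ≤ 2 ^ w →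
          (∀ x ∈ D, x < 2 ^ w) ∧
          ∀ i j : ℕ, i ≤ j → j < S.length →
            ∃ r : ℕ, IsRMQ S i j r ∧ IsInorderLCA (cartesianTree S) i j r ∧
              ∀ mem : List ℕ, mem.length = c * dagSize τ → (∀ x ∈ mem, x < 2 ^ w) →
                ∃ t : ℕ, t ≤ c * (dagDepth τ + 1) ∧ Answers w P D mem i j t r := by
  -- The constant 100 is generous: a record has 10 words, a query takes at most `38 * (dagDepth τ +
  -- 1) + 3` steps, and the addresses are less than `20 * S.length`.
  refine ⟨program, 100, fun S τ hτ => ⟨dataStructure τ, ?_, fun w hw => ?_⟩⟩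
  · rw [length_dataStructure]
    omega
  obtain ⟨F, hF, hshape⟩ := hτ.exists_shape
  obtain rfl : F = (inorder (cartesianTree S)).toFinset := by
    ext u
    have : u ∈ (F : Set Node) ↔ u ∈ nodes (cartesianTree S) := by rw [hF]
    simpa [nodes] using this
  have hcard : (inorder (cartesianTree S)).toFinset.card = S.length := by
    rw [List.toFinset_card_of_nodup (inorder_nodup _), length_inorder_cartesianTree]
  have hsize : size τ = S.length := hshape.ranks.1.symm.trans hcard
  have h2 := two_le_size τ
  have hdag := dagSize_add_three_le τ
  refine ⟨fun x hx => lt_of_mem_dataStructure hx (by omega) (by omega), fun i j hij hj => ?_⟩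
  obtain ⟨r, u, v, hrmq, hu, hv, hr⟩ := exists_isRMQ_lcp S hij hj
  refine ⟨r, hrmq, isInorderLCA_of_lcp hu hv hr, fun mem _ _ => ?_⟩
  have hstart : Halts w (dataStructure τ) (initConfig i j mem) (38 * (dagDepth τ + 1) + 3) r := by
    -- The invariant needs two distinct nodes; for `i = j` the program halts at once with the answer
    -- already in register 0.
    rcases hij.eq_or_lt with rfl | hij
    · obtain rfl : r = i := le_antisymm hrmq.2.1 hrmq.1
      exact .jumpEq rfl rfl (.halt rfl rfl)
    · refine .not_jumpEq rfl (by simp; omega) ?_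
      refine .const rfl (by omega) ?_
      refine .read rfl (topRank τ) ?_ ?_
      · have := dataStructure_getElem (self_mem_dagNodes τ) (record_zero (address τ) hshape)
        rw [address_self] at this
        exact this
      have hgoal : rk (inorder (cartesianTree S)).toFinset (lcp u v) = r := rk_inorder hr
      rw [← hgoal]
      -- At the source the cluster is the whole tree: ranks in it are inorder numbers, so both
      -- offsets are 0, and the global rank of the top is `topRank τ`.
      refine hshape.solves (N := S.length) (addr := address τ) (by omega)
        (fun ρ hρ => ⟨fun l x hx => dataStructure_getElem hρ hx, ?_⟩)
        i j 0 0 (topRank τ) ?_ _ _ ⟨rfl, rfl, (address_self τ).symm, rfl, rfl, rfl, rfl, rfl⟩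
      · have := address_add_ten_le hρ
        omega
      · refine ⟨⟨u, ?_, v, ?_, ?_, rk_inorder hu, rk_inorder hv, rfl⟩, ?_, ?_, ?_, ?_, ?_⟩
        · exact List.mem_toFinset.2 (List.mem_of_getElem? hu)
        · exact List.mem_toFinset.2 (List.mem_of_getElem? hv)
        · rw [← rk_lt_iff (List.mem_toFinset.2 (List.mem_of_getElem? hu))
            (List.mem_toFinset.2 (List.mem_of_getElem? hv)), rk_inorder hu, rk_inorder hv]
          exact hij
        · exact fun z _ _ => rfl
        · exact fun z _ _ => rfl
        · exact hshape.ranks.2.1.symm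
        · omega
        · omega
  obtain ⟨t, ht, h⟩ := hstart
  exact ⟨t, by omega, h⟩
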